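/- Let $H\in(0,1)$ and let $\Theta$ be a set of integrable functions $f:[0,1]\to\mathbb{R}$. For $f\in\Theta$ put $F_f(t)=\int_0^t f(u)\,du$, $t\in[0,1]$. For each $n\ge 1$ consider two statistical experiments with parameter set $\Theta$: (a) $\mathcal{E}_{1,n}(\Theta)=(\mathbb{R}^n,\mathcal{B}(\mathbb{R}^n),(P_f^n: f\in\Theta))$, where $P^n_f$ is the distribution of $(Y_{1,n},\dots,Y_{n,n})$ with $Y_{i,n}=f(i/n)+N_i^H$, and $(N_i^H)_i$ is fractional Gaussian noise, i.e. a centered stationary Gaussian process with autocovariance $\gamma(k)=\tfrac12\big(|k+1|^{2H}-2|k|^{2H}+|k-1|^{2H}\big)$; (b) $\mathcal{E}_{2,n}(\Theta)=(\mathcal{C}[0,1],\mathcal{B}(\mathcal{C}[0,1]),(Q_f^n: f\in\Theta))$, where $Q^n_f$ is the distribution of $Y_t=F_f(t)+n^{H-1}B_t^H$, $t\in[0,1]$, and $B^H$ is a fractional Brownian motion, i.e. a centered Gaussian process with continuous paths and covariance $K(s,t)=\tfrac12\big(|t|^{2H}+|s|^{2H}-|t-s|^{2H}\big)$. Let $(\mathbb{H},\|\cdot\|_{\mathbb{H}})$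 be the reproducing kernel Hilbert space of functions on $[0,1]$ with reproducing kernel $K$, with $\|g\|_{\mathbb{H}}:=\infty$ for $g\notin\mathbb{H}$. Suppose that, as $n\to\infty$, (i) $\displaystyle (n^{1-2H}\vee 1)\,\sup_{f\in\Theta}\sum_{i=1}^n\Big(n\int_{(i-1)/n}^{i/n}f(u)\,du-f\big(\tfrac in\big)\Big)^2\to 0$, and (ii) $\displaystyle n^{1-H}\,\sup_{f\in\Theta}\ \inf_{(\alpha_1,\dots,\alpha_n)\in\mathbb{R}^n}\Big\|F_f-\sum_{j=1}^n\alpha_j K\big(\cdot,\tfrac jn\big)\Big\|_{\mathbb{H}}\to 0$. Then $\mathcal{E}_{1,n}(\Theta)\simeq\mathcal{E}_{2,n}(\Theta)$, that is, the two sequences of experiments are asymptotically equivalent: their Le Cam distance $\Delta(\mathcal{E}_{1,n}(\Theta),\mathcal{E}_{2,n}(\Theta))$ tends to $0$ as $n\to\infty$. Here, for experiments $\mathcal{E}=(X,(P_f)_{f\in\Theta})$ and $\mathcal{F}=(Y,(Q_f)_{f\in\Theta})$, $\Delta(\mathcal{E},\mathcal{F})=\max\{\delta(\mathcal{E},\mathcal{F}),\delta(\mathcal{F},\mathcal{E})\}$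 with $\delta(\mathcal{E},\mathcal{F})=\inf_\kappa\sup_{f\in\Theta}\|\kappa P_f-Q_f\|_{TV}$, the infimum being over all Markov kernels $\kappa$ from $X$ to $Y$. -/

import Mathlib

open MeasureTheory ProbabilityTheory Filter Topology
open scoped ENNReal NNReal

/-! ### Statistical experiments and the Le Cam distance -/

/-- Total variation distance of two probability measures, `sup_A |μ(A) - ν(A)|`. -/
noncomputable def tvDist {X : Type*} [MeasurableSpace X] (μ ν : Measure X) : ℝ≥0∞ :=
  ⨆ (A : Set X) (_ : MeasurableSet A), ENNReal.ofReal |μ.real A - ν.real A|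

/-- Deficiency of the experiment `(X, (P θ)_θ)` with respect to `(Y, (Q θ)_θ)`: the infimum over all
Markov kernels `κ` from `X` to `Y` of `sup_θ ‖κ P_θ - Q_θ‖_TV`. -/
noncomputable def deficiency {ι X Y : Type*} [MeasurableSpace X] [MeasurableSpace Y]
    (P : ι → Measure X) (Q : ι → Measure Y) : ℝ≥0∞ :=
  ⨅ (κ : Kernel X Y) (_ : IsMarkovKernel κ), ⨆ θ : ι, tvDist (κ ∘ₘ P θ) (Q θ)

/-- Le Cam distance of two experiments with the same parameter set. -/
noncomputable def leCamDist {ι X Y : Type*} [MeasurableSpace X] [MeasurableSpace Y]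
    (P : ι → Measure X) (Q : ι → Measure Y) : ℝ≥0∞ :=
  max (deficiency P Q) (deficiency Q P)

/-- Two sequences of experiments with the same parameter set are asymptotically equivalent if their
Le Cam distance tends to zero. -/
def AsymptoticallyEquivalent {ι : Type*} {X Y : ℕ → Type*} [∀ n, MeasurableSpace (X n)]
    [∀ n, MeasurableSpace (Y n)] (P : ∀ n, ι → Measure (X n)) (Q : ∀ n, ι → Measure (Y n)) : Prop :=
  Tendsto (fun n ↦ leCamDist (P n) (Q n)) atTop (𝓝 0)

/-! ### The covariance kernel of fractional Brownian motion -/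

/-- The covariance function `(|t|^{2H} + |s|^{2H} - |t - s|^{2H}) / 2` of fractional Brownian motion
with Hurst parameter `H`. -/
noncomputable def fbmCov (H s t : ℝ) : ℝ :=
  (|t| ^ (2 * H) + |s| ^ (2 * H) - |t - s| ^ (2 * H)) / 2

theorem integrableOn_one_sub_cos_mul_rpow {H : ℝ} (hH : H ∈ Set.Ioo (0 : ℝ) 1) (t : ℝ) :
    IntegrableOn (fun x : ℝ ↦ (1 - Real.cos (t * x)) * x ^ (-1 - 2 * H)) (Set.Ioi 0) := by
  obtain ⟨h0, h1⟩ := hH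
  have hm : Measurable (fun x : ℝ ↦ (1 - Real.cos (t * x)) * x ^ (-1 - 2 * H)) := by fun_prop
  rw [← Set.Ioc_union_Ioi_eq_Ioi (zero_le_one' ℝ)]
  refine IntegrableOn.union ?_ ?_
  · have hi : IntegrableOn (fun x : ℝ ↦ t ^ 2 / 2 * x ^ (1 - 2 * H)) (Set.Ioc 0 1) := by
      have := (intervalIntegral.intervalIntegrable_rpow' (a := 0) (b := 1)
        (r := 1 - 2 * H) (by linarith)).const_mul (t ^ 2 / 2)
      rwa [intervalIntegrable_iff_integrableOn_Ioc_of_le zero_le_one] at this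
    refine Integrable.mono' hi hm.aestronglyMeasurable ?_
    refine (ae_restrict_iff' measurableSet_Ioc).2 (ae_of_all _ fun x hx ↦ ?_)
    have hx0 : 0 < x := hx.1
    have e : x ^ (1 - 2 * H) = x ^ 2 * x ^ (-1 - 2 * H) := by
      rw [← Real.rpow_natCast, ← Real.rpow_add hx0]; congr 1; push_cast; ring
    have hp := Real.rpow_nonneg hx0.le (-1 - 2 * H)
    have hc := Real.one_sub_sq_div_two_le_cos (x := t * x)
    have hc' := Real.cos_le_one (t * x)
    rw [Real.norm_of_nonneg (mul_nonneg (by linarith) hp), e, ← mul_assoc]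
    exact mul_le_mul_of_nonneg_right (by nlinarith) hp
  · have hi : IntegrableOn (fun x : ℝ ↦ 2 * x ^ (-1 - 2 * H)) (Set.Ioi 1) :=
      (integrableOn_Ioi_rpow_of_lt (by linarith) one_pos).const_mul 2
    refine Integrable.mono' hi hm.aestronglyMeasurable ?_
    refine (ae_restrict_iff' measurableSet_Ioi).2 (ae_of_all _ fun x hx ↦ ?_)
    have hx0 : 0 < x := one_pos.trans hx
    have hp := Real.rpow_nonneg hx0.le (-1 - 2 * H)
    have hc := Real.neg_one_le_cos (t * x)
    have hc' := Real.cos_le_one (t * x)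
    rw [Real.norm_of_nonneg (mul_nonneg (by linarith) hp)]
    exact mul_le_mul_of_nonneg_right (by linarith) hp

theorem integral_one_sub_cos_mul_rpow {H : ℝ} (hH : H ∈ Set.Ioo (0 : ℝ) 1) (t : ℝ) :
    ∫ x in Set.Ioi (0 : ℝ), (1 - Real.cos (t * x)) * x ^ (-1 - 2 * H) =
      |t| ^ (2 * H) * ∫ x in Set.Ioi (0 : ℝ), (1 - Real.cos x) * x ^ (-1 - 2 * H) := by
  obtain ⟨h0, h1⟩ := hH
  rcases eq_or_ne t 0 with rfl | ht
  · simp [Real.zero_rpow (by positivity : 2 * H ≠ 0)]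
  have hb : 0 < |t| := abs_pos.2 ht
  have h := integral_comp_mul_left_Ioi
    (fun x : ℝ ↦ (1 - Real.cos x) * x ^ (-1 - 2 * H)) 0 hb
  rw [mul_zero, smul_eq_mul] at h
  have h2 : ∫ x in Set.Ioi (0 : ℝ), (1 - Real.cos (t * x)) * x ^ (-1 - 2 * H) =
      |t| ^ (1 + 2 * H) *
        ∫ x in Set.Ioi (0 : ℝ), (1 - Real.cos (|t| * x)) * (|t| * x) ^ (-1 - 2 * H) := by
    rw [← integral_const_mul]
    refine setIntegral_congr_fun measurableSet_Ioi fun x hx ↦ ?_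
    have hx0 : 0 < x := hx
    have hc : Real.cos (|t| * x) = Real.cos (t * x) := by
      rw [← Real.cos_abs (t * x), abs_mul, abs_of_pos hx0]
    have hr : |t| ^ (1 + 2 * H) * |t| ^ (-1 - 2 * H) = 1 := by
      rw [← Real.rpow_add hb]; simp
    simp only [hc, Real.mul_rpow hb.le hx0.le]
    linear_combination (-(1 - Real.cos (t * x)) * x ^ (-1 - 2 * H)) * hr
  rw [h2, h, Real.rpow_add hb, Real.rpow_one]
  field_simp

theorem integral_one_sub_cos_mul_rpow_pos {H : ℝ} (hH : H ∈ Set.Ioo (0 : ℝ) 1) :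
    0 < ∫ x in Set.Ioi (0 : ℝ), (1 - Real.cos x) * x ^ (-1 - 2 * H) := by
  have hi := integrableOn_one_sub_cos_mul_rpow hH 1
  simp only [one_mul] at hi
  rw [setIntegral_pos_iff_support_of_nonneg_ae _ hi]
  · refine lt_of_lt_of_le ?_ (measure_mono (s := Set.Ioo (0 : ℝ) 1) fun x hx ↦ ⟨?_, hx.1⟩)
    · simp
    · have hp := Real.rpow_pos_of_pos hx.1 (-1 - 2 * H)
      have hc : Real.cos x < 1 := by
        have := Real.cos_lt_cos_of_nonneg_of_le_pi le_rfl
          (by linarith [hx.2, Real.pi_gt_three]) hx.1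
        simpa using this
      exact (mul_pos (sub_pos.2 hc) hp).ne'
  · refine (ae_restrict_iff' measurableSet_Ioi).2 (ae_of_all _ fun x hx ↦ ?_)
    exact mul_nonneg (sub_nonneg.2 (Real.cos_le_one x)) (Real.rpow_nonneg (le_of_lt hx) _)

/-- The covariance function of fractional Brownian motion is positive semidefinite. -/
theorem fbmCov_sum_nonneg {H : ℝ} (hH : H ∈ Set.Ioo (0 : ℝ) 1) {ι : Type*} (I : Finset ι)
    (t c : ι → ℝ) : 0 ≤ ∑ i ∈ I, ∑ j ∈ I, c i * c j * fbmCov H (t i) (t j) := by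
  set C := ∫ x in Set.Ioi (0 : ℝ), (1 - Real.cos x) * x ^ (-1 - 2 * H) with hC
  have hCpos : 0 < C := integral_one_sub_cos_mul_rpow_pos hH
  have hint := integrableOn_one_sub_cos_mul_rpow hH
  have key : ∀ s t : ℝ, C * fbmCov H s t = ∫ x in Set.Ioi (0 : ℝ),
      ((1 - Real.cos (s * x)) * (1 - Real.cos (t * x)) + Real.sin (s * x) * Real.sin (t * x)) / 2
        * x ^ (-1 - 2 * H) := by
    intro s t
    have e : C * fbmCov H s t = (|t| ^ (2 * H) * C + |s| ^ (2 * H) * C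
        - |t - s| ^ (2 * H) * C) / 2 := by unfold fbmCov; ring
    rw [e, hC, ← integral_one_sub_cos_mul_rpow hH, ← integral_one_sub_cos_mul_rpow hH,
      ← integral_one_sub_cos_mul_rpow hH, ← integral_add (hint t) (hint s),
      ← integral_sub (f := fun x : ℝ ↦ (1 - Real.cos (t * x)) * x ^ (-1 - 2 * H)
        + (1 - Real.cos (s * x)) * x ^ (-1 - 2 * H)) ((hint t).add (hint s)) (hint (t - s)),
      ← integral_div]
    refine integral_congr_ae (ae_of_all _ fun x ↦ ?_)
    simp only [sub_mul t s x, Real.cos_sub]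
    ring
  have keyint : ∀ s t : ℝ, IntegrableOn (fun x : ℝ ↦
      ((1 - Real.cos (s * x)) * (1 - Real.cos (t * x)) + Real.sin (s * x) * Real.sin (t * x)) / 2
        * x ^ (-1 - 2 * H)) (Set.Ioi 0) := by
    intro s t
    refine ((((hint t).add (hint s)).sub (hint (t - s))).div_const 2).congr
      (ae_of_all _ fun x ↦ ?_)
    simp only [Pi.add_apply, Pi.sub_apply, sub_mul t s x, Real.cos_sub]
    ring
  refine nonneg_of_mul_nonneg_right (a := C) ?_ hCpos
  have e : C * ∑ i ∈ I, ∑ j ∈ I, c i * c j * fbmCov H (t i) (t j) =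
      ∫ x in Set.Ioi (0 : ℝ), ∑ i ∈ I, ∑ j ∈ I, c i * c j *
      (((1 - Real.cos (t i * x)) * (1 - Real.cos (t j * x)) +
        Real.sin (t i * x) * Real.sin (t j * x)) / 2 * x ^ (-1 - 2 * H)) := by
    rw [integral_finsetSum _ fun i _ ↦ integrable_finsetSum _ fun j _ ↦
      (keyint (t i) (t j)).const_mul _, Finset.mul_sum]
    refine Finset.sum_congr rfl fun i _ ↦ ?_
    rw [integral_finsetSum _ fun j _ ↦ (keyint (t i) (t j)).const_mul _, Finset.mul_sum]
    refine Finset.sum_congr rfl fun j _ ↦ ?_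
    rw [integral_const_mul, ← key]
    ring
  rw [e]
  refine setIntegral_nonneg measurableSet_Ioi fun x hx ↦ ?_
  have e2 : (∑ i ∈ I, ∑ j ∈ I, c i * c j *
      (((1 - Real.cos (t i * x)) * (1 - Real.cos (t j * x)) +
        Real.sin (t i * x) * Real.sin (t j * x)) / 2 * x ^ (-1 - 2 * H))) =
      ((∑ i ∈ I, c i * (1 - Real.cos (t i * x))) ^ 2 +
        (∑ i ∈ I, c i * Real.sin (t i * x)) ^ 2) / 2 * x ^ (-1 - 2 * H) := by
    rw [sq, sq, Finset.sum_mul_sum, Finset.sum_mul_sum, ← Finset.sum_add_distrib,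
      Finset.sum_div, Finset.sum_mul]
    refine Finset.sum_congr rfl fun i _ ↦ ?_
    rw [← Finset.sum_add_distrib, Finset.sum_div, Finset.sum_mul]
    refine Finset.sum_congr rfl fun j _ ↦ ?_
    ring
  rw [e2]
  exact mul_nonneg (by positivity) (Real.rpow_nonneg (le_of_lt hx) _)

/-- The covariance function of fractional Brownian motion on `[0, 1]`, as a kernel in the format of
Mathlib's `RKHS` (a real number `c` is identified with multiplication by `c`). -/
noncomputable def fbmKernel (H : ℝ) : Matrix unitInterval unitInterval (ℝ →L[ℝ] ℝ) :=
  Matrix.of fun s t ↦ fbmCov H s t • (1 : ℝ →L[ℝ] ℝ)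

theorem fbmCov_comm (H s t : ℝ) : fbmCov H s t = fbmCov H t s := by
  unfold fbmCov; rw [abs_sub_comm]; ring

theorem fbmKernel_posSemidef {H : ℝ} (hH : H ∈ Set.Ioo (0 : ℝ) 1) :
    (fbmKernel H).PosSemidef := by
  have htfae := (RKHS.posSemidef_tfae (K := fbmKernel H)).out 0 2
  rw [htfae]
  refine ⟨?_, fun v ↦ ?_⟩
  · refine Matrix.IsHermitian.ext fun s t ↦ ?_
    ext
    simp [fbmKernel, fbmCov_comm H s t]
  · have h := fbmCov_sum_nonneg hH v.support (fun i ↦ (i : ℝ)) v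
    simp only [Finsupp.sum, RCLike.re_to_real]
    refine h.trans_eq (Finset.sum_congr rfl fun i _ ↦ Finset.sum_congr rfl fun j _ ↦ ?_)
    simp [fbmKernel, fbmCov_comm H j i]
    ring

/-! ### The reproducing kernel Hilbert space norm -/

/-- The norm of a function `g` in the reproducing kernel Hilbert space with kernel `K`; it is `∞` if
`g` does not belong to that space. (At most one element `φ` of the space has `g` as its underlying
function.) -/
noncomputable def rkhsENorm {X : Type*} (K : Matrix X X (ℝ →L[ℝ] ℝ)) [Fact K.PosSemidef]
    (g : X → ℝ) : ℝ≥0∞ :=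
  ⨅ (φ : RKHS.OfKernel K) (_ : ⇑φ = g), ‖φ‖ₑ

/-- The norm of the reproducing kernel Hilbert space of fractional Brownian motion on `[0, 1]`,
with value `∞` outside that space. -/
noncomputable def fbmRKHSENorm {H : ℝ} (hH : H ∈ Set.Ioo (0 : ℝ) 1) (g : unitInterval → ℝ) :
    ℝ≥0∞ :=
  haveI : Fact (fbmKernel H).PosSemidef := ⟨fbmKernel_posSemidef hH⟩
  rkhsENorm (fbmKernel H) g

/-! ### Fractional Gaussian noise and fractional Brownian motion -/

/-- Fractional Gaussian noise with Hurst index `H`: a centered stationary Gaussian sequence with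
autocovariance `γ(k) = (|k + 1|^{2H} - 2|k|^{2H} + |k - 1|^{2H}) / 2`. -/
structure IsFractionalGaussianNoise {Ω : Type*} [MeasurableSpace Ω] (H : ℝ) (N : ℕ → Ω → ℝ)
    (P : Measure Ω) : Prop where
  measurable : ∀ i, Measurable (N i)
  isGaussianProcess : IsGaussianProcess N P
  mean_eq_zero : ∀ i, P[N i] = 0
  covariance_eq : ∀ i j, cov[N i, N j; P] =
    (|(i : ℝ) - j + 1| ^ (2 * H) - 2 * |(i : ℝ) - j| ^ (2 * H) + |(i : ℝ) - j - 1| ^ (2 * H)) / 2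

/-- Fractional Brownian motion with Hurst parameter `H`: a centered Gaussian process
`(B_t)_{t ≥ 0}` with continuous sample paths and covariance function `fbmCov H`. -/
structure IsFractionalBrownianMotion {Ω : Type*} [MeasurableSpace Ω] (H : ℝ) (B : ℝ≥0 → Ω → ℝ)
    (P : Measure Ω) : Prop where
  measurable : ∀ t, Measurable (B t)
  isGaussianProcess : IsGaussianProcess B P
  mean_eq_zero : ∀ t, P[B t] = 0
  covariance_eq : ∀ s t, cov[B s, B t; P] = fbmCov H s t
  continuous_path : ∀ ω, Continuous fun t ↦ B t ω

/-- The restriction to `[0, 1]` of a sample path of fractional Brownian motion. -/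
def IsFractionalBrownianMotion.path {Ω : Type*} [MeasurableSpace Ω] {H : ℝ} {B : ℝ≥0 → Ω → ℝ}
    {P : Measure Ω} (hB : IsFractionalBrownianMotion H B P) (ω : Ω) : C(unitInterval, ℝ) where
  toFun t := B ⟨t, t.2.1⟩ ω
  continuous_toFun := (hB.continuous_path ω).comp (by fun_prop)

/-! ### The two experiments -/

/-- The anti-derivative `F_f(t) = ∫_0^t f(u) du` on `[0, 1]` of an integrable function `f`. -/
noncomputable def antiderivative (f : ℝ → ℝ) (hf : IntervalIntegrable f volume 0 1) :
    C(unitInterval, ℝ) where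
  toFun t := ∫ u in (0 : ℝ)..t, f u
  continuous_toFun := by
    have h := intervalIntegral.continuousOn_primitive_interval'
      (f := f) (μ := volume) (a := 0) (b₁ := 0) (b₂ := 1) hf (by simp)
    rw [Set.uIcc_of_le zero_le_one] at h
    exact continuousOn_iff_continuous_domRestrict.1 h

/-- `C[0, 1]` with the uniform norm carries its Borel σ-algebra. -/
instance instMeasurableSpaceContinuousMapUnitInterval : MeasurableSpace C(unitInterval, ℝ) :=
  borel _

instance instBorelSpaceContinuousMapUnitInterval : BorelSpace C(unitInterval, ℝ) :=
  ⟨rfl⟩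

/-- The distribution on `ℝⁿ` of the observations `Y_i = f(i/n) + N_i`, `i = 1, …, n`. -/
noncomputable def regressionLaw {Ω : Type*} [MeasurableSpace Ω] (N : ℕ → Ω → ℝ) (P : Measure Ω)
    (n : ℕ) (f : ℝ → ℝ) : Measure (Fin n → ℝ) :=
  P.map fun ω (i : Fin n) ↦ f (((i : ℝ) + 1) / n) + N ((i : ℕ) + 1) ω

/-- The distribution on `C[0, 1]` of the path `Y_t = ∫_0^t f(u) du + n^{H-1} B_t`, `t ∈ [0, 1]`. -/
noncomputable def continuousLaw {Ω : Type*} [MeasurableSpace Ω] {H : ℝ} {B : ℝ≥0 → Ω → ℝ}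
    {P : Measure Ω} (hB : IsFractionalBrownianMotion H B P) (n : ℕ) (f : ℝ → ℝ)
    (hf : IntervalIntegrable f volume 0 1) : Measure C(unitInterval, ℝ) :=
  P.map fun ω ↦ antiderivative f hf + ((n : ℝ) ^ (H - 1)) • hB.path ω

/-! ### Total variation distance -/

section TotalVariation

variable {X Y Z : Type*} [MeasurableSpace X] [MeasurableSpace Y] [MeasurableSpace Z]

/-! The two experiments are compared through a third one, the rescaled increments `n (Y (i / n) - Y
((i - 1) / n))` of the observed path. By self-similarity and stationarity of increments these are
the local averages of `f` over the grid cells plus a vector with exactly the law of the regression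
noise. Two Gaussian shift problems remain.

Regression against increments: the noise law is the same and the means differ by a vector `d`.
Shifting a centered Gaussian vector with covariance `Γ` by `d` costs at most `2 √(dᵀ Γ⁻¹ d)` in
total variation. The spectral representation of `Γ` bounds its smallest eigenvalue below by a
multiple of `min (n ^ (2 * H - 1)) 1` (`exists_pos_mul_sum_sq_le`), so this cost is controlled by
the quantity in (i).

Increments against path: the noise path is the sum of the interpolation of its increments and a
residual which is independent of the increments and whose law does not involve `f`. The residual can
therefore be simulated. Adding it to the interpolated increments gives a path with the right noise
but with drift `L F` in place of `F`, where `L` interpolates the values on the grid. When the norms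
in (ii) are finite, `L F` is the orthogonal projection of `F` on the span of the kernel functions at
grid points, so the norm of `F - L F` is at most the infimum in (ii)
(`exists_coe_eq_sub_interpolate`). Changing the drift then costs at most `2 n ^ (1 - H)` times that
norm.

Both costs come from `IsPathSpace.tvDist_map_add_le`, which reduces a shift by a covariance function
to a shift of one real Gaussian variable. Density of the kernel functions extends it to the whole
reproducing kernel Hilbert space (`IsFractionalBrownianMotion.tvDist_map_path_add_le`). -/

/-- Passing to complements turns the one-sided bound into the two-sided one, since both total masses
are one. -/
theorem tvDist_le_of_forall_measure_le {μ ν : Measure X} [IsProbabilityMeasure μ]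
    [IsProbabilityMeasure ν] {c : ℝ≥0∞} (h : ∀ A, MeasurableSet A → μ A ≤ ν A + c) :
    tvDist μ ν ≤ c := by
  rcases eq_or_ne c ∞ with rfl | hc
  · exact le_top
  have hr : ∀ A, MeasurableSet A → μ.real A ≤ ν.real A + c.toReal := fun A hA ↦ by
    rw [measureReal_def, measureReal_def, ← ENNReal.toReal_add (measure_ne_top _ _) hc]
    exact ENNReal.toReal_mono (ENNReal.add_ne_top.2 ⟨measure_ne_top _ _, hc⟩) (h A hA)
  refine iSup₂_le fun A hA ↦ ENNReal.ofReal_le_of_le_toReal (abs_le.2 ⟨?_, ?_⟩)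
  · have := hr Aᶜ hA.compl
    rw [probReal_compl_eq_one_sub hA, probReal_compl_eq_one_sub hA] at this
    linarith
  · linarith [hr A hA]

theorem measure_le_add_tvDist (μ ν : Measure X) [IsFiniteMeasure μ] [IsFiniteMeasure ν]
    {A : Set X} (hA : MeasurableSet A) : μ A ≤ ν A + tvDist μ ν := by
  have h : ENNReal.ofReal |μ.real A - ν.real A| ≤ tvDist μ ν :=
    le_iSup₂ (f := fun (A : Set X) (_ : MeasurableSet A) ↦
      ENNReal.ofReal |μ.real A - ν.real A|) A hA
  refine le_trans ?_ (add_le_add_right h _)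
  rw [← ofReal_measureReal (μ := μ), ← ofReal_measureReal (μ := ν),
    ← ENNReal.ofReal_add measureReal_nonneg (abs_nonneg _)]
  exact ENNReal.ofReal_le_ofReal (by linarith [le_abs_self (μ.real A - ν.real A)])

theorem tvDist_comm (μ ν : Measure X) : tvDist μ ν = tvDist ν μ := by
  unfold tvDist
  simp_rw [abs_sub_comm]

theorem tvDist_triangle (μ ν ρ : Measure X) [IsProbabilityMeasure μ] [IsProbabilityMeasure ν]
    [IsProbabilityMeasure ρ] : tvDist μ ρ ≤ tvDist μ ν + tvDist ν ρ := by
  refine tvDist_le_of_forall_measure_le fun A hA ↦ ?_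
  calc μ A ≤ ν A + tvDist μ ν := measure_le_add_tvDist μ ν hA
    _ ≤ (ρ A + tvDist ν ρ) + tvDist μ ν := by gcongr; exact measure_le_add_tvDist ν ρ hA
    _ = ρ A + (tvDist μ ν + tvDist ν ρ) := by ring

theorem tvDist_map_le (μ ν : Measure X) [IsProbabilityMeasure μ] [IsProbabilityMeasure ν]
    {g : X → Y} (hg : Measurable g) : tvDist (μ.map g) (ν.map g) ≤ tvDist μ ν := by
  have := Measure.isProbabilityMeasure_map (μ := μ) hg.aemeasurable
  have := Measure.isProbabilityMeasure_map (μ := ν) hg.aemeasurable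
  refine tvDist_le_of_forall_measure_le fun A hA ↦ ?_
  rw [Measure.map_apply hg hA, Measure.map_apply hg hA]
  exact measure_le_add_tvDist μ ν (hg hA)

theorem tvDist_prod_le (μ ν : Measure X) (ρ : Measure Y) [IsProbabilityMeasure μ]
    [IsProbabilityMeasure ν] [IsProbabilityMeasure ρ] :
    tvDist (μ.prod ρ) (ν.prod ρ) ≤ tvDist μ ν := by
  refine tvDist_le_of_forall_measure_le fun A hA ↦ ?_
  rw [Measure.prod_apply_symm hA, Measure.prod_apply_symm hA]
  calc ∫⁻ y, μ ((fun x ↦ (x, y)) ⁻¹' A) ∂ρ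
      ≤ ∫⁻ y, (ν ((fun x ↦ (x, y)) ⁻¹' A) + tvDist μ ν) ∂ρ :=
        lintegral_mono fun y ↦ measure_le_add_tvDist μ ν (measurable_prodMk_right hA)
    _ = _ := by rw [lintegral_add_right _ measurable_const]; simp

/-- If `V` is independent of `Z`, replacing `Z` by a variable with another law, still independent
of `V`, changes the law of `g (Z, V)` at most by the total variation distance of the two laws. -/
theorem tvDist_map_prod_le {Ω : Type*} [MeasurableSpace Ω] {P : Measure Ω}
    [IsProbabilityMeasure P] {U U' : Ω → X} {V : Ω → Y} (hU : Measurable U) (hU' : Measurable U')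
    (hV : Measurable V) (h : IndepFun U V P) (h' : IndepFun U' V P) {g : X × Y → Z}
    (hg : Measurable g) :
    tvDist (P.map fun ω ↦ g (U ω, V ω)) (P.map fun ω ↦ g (U' ω, V ω)) ≤
      tvDist (P.map U) (P.map U') := by
  have := Measure.isProbabilityMeasure_map (μ := P) hU.aemeasurable
  have := Measure.isProbabilityMeasure_map (μ := P) hU'.aemeasurable
  have := Measure.isProbabilityMeasure_map (μ := P) hV.aemeasurable
  have e : ∀ W : Ω → X, Measurable W → IndepFun W V P →
      P.map (fun ω ↦ g (W ω, V ω)) = ((P.map W).prod (P.map V)).map g := fun W hW hi ↦ by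
    rw [← (indepFun_iff_map_prod_eq_prod_map_map hW.aemeasurable hV.aemeasurable).1 hi,
      Measure.map_map hg (hW.prodMk hV)]
    rfl
  rw [e U hU h, e U' hU' h']
  exact (tvDist_map_le _ _ hg).trans (tvDist_prod_le _ _ _)

theorem tvDist_le_one (μ ν : Measure X) [IsProbabilityMeasure μ] [IsProbabilityMeasure ν] :
    tvDist μ ν ≤ 1 :=
  tvDist_le_of_forall_measure_le fun _ _ ↦ prob_le_one.trans le_add_self

/-- The density ratio is `exp (a x - a² / 2) ≥ 1 + a x - a² / 2`, and `-a x ≤ |a| (1 + x²) / 2`.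
Integrating the deficit under the standard Gaussian gives `a² / 2 + |a|`, which is below `2 |a|`
when `|a| < 1`; otherwise the trivial bound by one suffices. -/
theorem tvDist_gaussianReal_le (a : ℝ) :
    tvDist (gaussianReal 0 1) (gaussianReal a 1) ≤ ENNReal.ofReal (2 * |a|) := by
  rcases le_or_gt 1 |a| with h1 | h1
  · refine (tvDist_le_one _ _).trans ?_
    rw [← ENNReal.ofReal_one]
    exact ENNReal.ofReal_le_ofReal (by linarith)
  have hint : Integrable (fun x : ℝ ↦ a ^ 2 / 2 + |a| * ((1 + x ^ 2) / 2)) (gaussianReal 0 1) := by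
    have h2 : Integrable (fun x : ℝ ↦ x ^ 2) (gaussianReal 0 1) :=
      (memLp_id_gaussianReal 2).integrable_sq
    fun_prop
  have hval : ∫ x, a ^ 2 / 2 + |a| * ((1 + x ^ 2) / 2) ∂(gaussianReal 0 1) = a ^ 2 / 2 + |a| := by
    have h2 : Integrable (fun x : ℝ ↦ x ^ 2) (gaussianReal 0 1) :=
      (memLp_id_gaussianReal 2).integrable_sq
    have hv : ∫ x, x ^ 2 ∂(gaussianReal 0 1) = 1 := by
      have := variance_eq_sub (μ := gaussianReal 0 1) (X := id) (memLp_id_gaussianReal 2)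
      rw [variance_id_gaussianReal] at this
      simpa using this.symm
    rw [integral_add (by fun_prop) (by fun_prop), integral_const_mul, integral_div 2 (1 + · ^ 2),
      integral_add (by fun_prop) h2, hv]
    simp
  have hpdf : ∀ x, gaussianPDF 0 1 x ≤ gaussianPDF a 1 x +
      gaussianPDF 0 1 x * ENNReal.ofReal (a ^ 2 / 2 + |a| * ((1 + x ^ 2) / 2)) := fun x ↦ by
    have h0 := gaussianPDFReal_nonneg 0 1 x
    have ha := gaussianPDFReal_nonneg a 1 x
    rw [gaussianPDF, gaussianPDF, ← ENNReal.ofReal_mul h0, ← ENNReal.ofReal_add ha (by positivity)]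
    refine ENNReal.ofReal_le_ofReal ?_
    have e : gaussianPDFReal a 1 x = gaussianPDFReal 0 1 x * Real.exp (a * x - a ^ 2 / 2) := by
      simp only [gaussianPDFReal]
      rw [mul_assoc (√_)⁻¹, ← Real.exp_add]
      congr 2
      simp
      ring
    have h3 := Real.add_one_le_exp (a * x - a ^ 2 / 2)
    have h4 : -(a * x) ≤ |a| * ((1 + x ^ 2) / 2) := by
      have : -(a * x) ≤ |a| * |x| := by rw [← abs_mul]; exact neg_le_abs _
      nlinarith [sq_nonneg (|x| - 1), sq_abs x, abs_nonneg a]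
    rw [e, ← mul_add]
    exact le_mul_of_one_le_right h0 (by linarith)
  refine tvDist_le_of_forall_measure_le fun A hA ↦ ?_
  rw [gaussianReal_apply _ one_ne_zero, gaussianReal_apply _ one_ne_zero]
  calc ∫⁻ x in A, gaussianPDF 0 1 x
      ≤ ∫⁻ x in A, (gaussianPDF a 1 x +
          gaussianPDF 0 1 x * ENNReal.ofReal (a ^ 2 / 2 + |a| * ((1 + x ^ 2) / 2))) :=
        lintegral_mono hpdf
    _ ≤ (∫⁻ x in A, gaussianPDF a 1 x) +
          ∫⁻ x, gaussianPDF 0 1 x * ENNReal.ofReal (a ^ 2 / 2 + |a| * ((1 + x ^ 2) / 2)) := by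
        rw [lintegral_add_left (measurable_gaussianPDF _ _)]
        gcongr
        exact Measure.restrict_le_self
    _ ≤ _ := by
        gcongr
        have e := lintegral_withDensity_eq_lintegral_mul volume (measurable_gaussianPDF 0 1)
          (g := fun x ↦ ENNReal.ofReal (a ^ 2 / 2 + |a| * ((1 + x ^ 2) / 2))) (by fun_prop)
        simp only [Pi.mul_apply] at e
        rw [← e, ← gaussianReal_of_var_ne_zero _ one_ne_zero,
          ← ofReal_integral_eq_lintegral_ofReal hint (ae_of_all _ fun x ↦ by positivity), hval]
        refine ENNReal.ofReal_le_ofReal ?_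
        nlinarith [sq_abs a, abs_nonneg a]

end TotalVariation

/-! ### Linear transformations and shifts of Gaussian processes -/

section GaussianProcess

variable {Ω : Type*} [MeasurableSpace Ω] {P : Measure Ω}

theorem isGaussianProcess_of_mem_span {S T : Type*} {X : T → Ω → ℝ} {Y : S → Ω → ℝ}
    (hX : IsGaussianProcess X P) (h : ∀ s, Y s ∈ Submodule.span ℝ (Set.range X)) :
    IsGaussianProcess Y P := by
  refine hX.of_isGaussianProcess fun s ↦ ?_
  obtain ⟨c, hc⟩ := Finsupp.mem_span_range_iff_exists_finsupp.1 (h s)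
  refine ⟨c.support, ∑ i : c.support, c i • ContinuousLinearMap.proj i, fun ω ↦ ?_⟩
  rw [← hc, Finsupp.sum, Finset.sum_apply, ← Finset.sum_coe_sort]
  simp

theorem hasGaussianLaw_pi_of_isGaussianProcess {ι : Type*} [Fintype ι] {X : ι → Ω → ℝ}
    (hX : IsGaussianProcess X P) : HasGaussianLaw (fun ω i ↦ X i ω) P :=
  (hX.hasGaussianLaw Finset.univ).map_fun (ContinuousLinearMap.pi fun i ↦
    (ContinuousLinearMap.proj ⟨i, Finset.mem_univ i⟩ : (∀ _ : (Finset.univ : Finset ι), ℝ) →L[ℝ] ℝ))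

/-- A linear space of functions on `T` whose σ-algebra is generated by the evaluations. -/
structure IsPathSpace {T E : Type*} [AddCommGroup E] [Module ℝ E] [mE : MeasurableSpace E]
    (ev : E →ₗ[ℝ] (T → ℝ)) : Prop where
  injective : Function.Injective ev
  comap_eq : mE = MeasurableSpace.comap ev MeasurableSpace.pi

namespace IsPathSpace

variable {T E : Type*} [AddCommGroup E] [Module ℝ E] [mE : MeasurableSpace E]
  {ev : E →ₗ[ℝ] (T → ℝ)}

theorem pi (T : Type*) : IsPathSpace (LinearMap.id : (T → ℝ) →ₗ[ℝ] (T → ℝ)) where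
  injective := Function.injective_id
  comap_eq := MeasurableSpace.comap_id.symm

theorem measurable_iff (hE : IsPathSpace ev) {α : Type*} [MeasurableSpace α] {f : α → E} :
    Measurable f ↔ ∀ t, Measurable fun a ↦ ev (f a) t := by
  have h : Measurable f ↔ Measurable (ev ∘ f) := by
    rw [hE.comap_eq]
    exact measurable_comap_iff
  rw [h, measurable_pi_iff]
  rfl

theorem measurable_eval (hE : IsPathSpace ev) (t : T) : Measurable fun x ↦ ev x t :=
  hE.measurable_iff.1 measurable_id t

theorem indepFun (hE : IsPathSpace ev) {F : Type*} [MeasurableSpace F] {U : Ω → F} {V : Ω → E}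
    (h : IndepFun U (fun ω ↦ ev (V ω)) P) : IndepFun U V P := by
  rw [IndepFun_iff_Indep] at h ⊢
  rwa [hE.comap_eq, MeasurableSpace.comap_comp]

/-- The residual of a Gaussian process after projection on finitely many Gaussian variables `U` with
Gram matrix `A⁻¹` is independent of `U`. -/
theorem indepFun_residual (hE : IsPathSpace ev) {ι : Type*} [Fintype ι] [DecidableEq ι]
    {U : ι → Ω → ℝ} {X : T → Ω → ℝ} (hG : IsGaussianProcess (Sum.elim U X) P)
    (hU : ∀ i, Measurable (U i)) (hX : ∀ t, Measurable (X t)) {path : Ω → E}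
    (hpath : ∀ ω t, ev (path ω) t = X t ω) {A : Matrix ι ι ℝ}
    (hA : ∀ i j, ∑ k, A j k * cov[U i, U k; P] = if i = j then 1 else 0) {e : ι → E}
    (he : ∀ j t, ev (e j) t = cov[X t, U j; P]) :
    IndepFun (fun ω i ↦ U i ω) (fun ω ↦ path ω - ∑ j, (∑ k, A j k * U k ω) • e j) P := by
  have := hG.isProbabilityMeasure
  have hUL : ∀ i, MemLp (U i) 2 P := fun i ↦ (hG.hasGaussianLaw_eval (.inl i)).memLp_two
  have hXL : ∀ t, MemLp (X t) 2 P := fun t ↦ (hG.hasGaussianLaw_eval (.inr t)).memLp_two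
  have hR : (fun ω ↦ ev (path ω - ∑ j, (∑ k, A j k * U k ω) • e j)) =
      fun ω t ↦ X t ω - ∑ j, (∑ k, A j k * U k ω) * ev (e j) t := by
    ext ω t
    simp [hpath]
  refine hE.indepFun ?_
  rw [hR]
  refine IsGaussianProcess.indepFun_of_covariance_eq_zero
    (Y := fun t ω ↦ X t ω - ∑ j, (∑ k, A j k * U k ω) * ev (e j) t)
    (isGaussianProcess_of_mem_span hG ?_) (fun i ↦ (hU i).aemeasurable)
    (fun t ↦ Measurable.aemeasurable (by fun_prop)) fun i t ↦ ?_
  · rintro (i | t)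
    · exact Submodule.subset_span ⟨.inl i, rfl⟩
    · have : (fun ω ↦ X t ω - ∑ j, (∑ k, A j k * U k ω) * ev (e j) t) =
          X t - ∑ j, ev (e j) t • ∑ k, A j k • U k := by
        ext ω
        simp [mul_comm]
      simp only [Sum.elim_inr, this]
      refine sub_mem (Submodule.subset_span ⟨.inr t, rfl⟩) (sum_mem fun j _ ↦
        Submodule.smul_mem _ _ (sum_mem fun k _ ↦ Submodule.smul_mem _ _
          (Submodule.subset_span ⟨.inl k, rfl⟩)))
  -- For jointly Gaussian families zero covariance is enough. Since `A` inverts the Gram matrix, the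
  -- subtracted sum has covariance `ev (e i) t` with `U i`, which is that of `X t`.
  · have h1 : ∀ j, MemLp (fun ω ↦ ∑ k, A j k * U k ω) 2 P := fun j ↦
      memLp_finsetSum _ fun k _ ↦ (hUL k).const_mul _
    rw [covariance_fun_sub_right (hUL i) (hXL t)
      (memLp_finsetSum _ fun j _ ↦ (h1 j).mul_const _),
      covariance_fun_sum_right (fun j ↦ (h1 j).mul_const _) (hUL i)]
    have h2 : ∀ j, cov[U i, fun ω ↦ (∑ k, A j k * U k ω) * ev (e j) t; P] =
        if i = j then ev (e j) t else 0 := fun j ↦ by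
      rw [covariance_mul_const_right, covariance_fun_sum_right (fun k ↦ (hUL k).const_mul _)
        (hUL i)]
      simp_rw [covariance_const_mul_right, hA]
      simp
    simp_rw [h2]
    simp [he, covariance_comm (U i)]

/-- Shifting a centered Gaussian process by the covariance function `t ↦ cov (X t, U)` changes its
law by at most twice the standard deviation of `U` in total variation. -/
theorem tvDist_map_add_le (hE : IsPathSpace ev) {U : Ω → ℝ} {X : T → Ω → ℝ}
    (hG : IsGaussianProcess (Sum.elim (fun _ : Unit ↦ U) X) P) (hU : Measurable U)
    (hU0 : P[U] = 0) (hX : ∀ t, Measurable (X t)) {path : Ω → E}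
    (hpath : ∀ ω t, ev (path ω) t = X t ω) {h : E} (hh : ∀ t, ev h t = cov[X t, U; P]) :
    tvDist (P.map path) (P.map fun ω ↦ path ω + h) ≤ ENNReal.ofReal (2 * √Var[U; P]) := by
  have := hG.isProbabilityMeasure
  have hUL : MemLp U 2 P := (hG.hasGaussianLaw_eval (.inl ())).memLp_two
  have hXL : ∀ t, MemLp (X t) 2 P := fun t ↦ (hG.hasGaussianLaw_eval (.inr t)).memLp_two
  rcases (variance_nonneg U P).eq_or_lt with h0 | hpos
  -- If `U` is almost surely constant, its covariance function vanishes and there is no shift.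
  · have hz : h = 0 := by
      refine hE.injective (funext fun t ↦ ?_)
      have hc := ae_eq_integral_of_variance_eq_zero hUL h0.symm
      rw [hh, covariance, map_zero]
      refine integral_eq_zero_of_ae (hc.mono fun ω hω ↦ ?_)
      simp [hω]
    simp [hz, tvDist]
  set σ := √Var[U; P] with hσ
  have hσ2 : σ ^ 2 = Var[U; P] := Real.sq_sqrt hpos.le
  have hσ0 : 0 < σ := Real.sqrt_pos.2 hpos
  -- Write the path as `V + (U / σ²) • h` with `V` independent of `U`. Replacing `U` by `U + σ²`
  -- adds exactly `h`, so only the laws of `U` and `U + σ²` need comparing.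
  have hlaw : P.map U = gaussianReal 0 (Var[U; P].toNNReal) := by
    have : HasGaussianLaw U P := hG.hasGaussianLaw_eval (.inl ())
    rw [this.map_eq_gaussianReal, hU0]
  have hpm : Measurable path := hE.measurable_iff.2 fun t ↦ by simpa [hpath] using hX t
  set V : Ω → E := fun ω ↦ path ω - ((σ ^ 2)⁻¹ * U ω) • h with hV
  have hVm : Measurable V := hE.measurable_iff.2 fun t ↦ by
    have := hX t
    simp only [hV, map_sub, map_smul, Pi.sub_apply, Pi.smul_apply, hpath]
    fun_prop
  have hi : IndepFun U V P := by
    have := hE.indepFun_residual hG (fun _ ↦ hU) hX hpath (A := fun _ _ ↦ (σ ^ 2)⁻¹)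
      (fun _ _ ↦ by simp [covariance_self hU.aemeasurable, ← hσ2, hσ0.ne']) (e := fun _ ↦ h)
      (fun _ t ↦ hh t)
    have := this.comp (measurable_pi_apply ()) measurable_id
    simpa [Function.comp_def] using this
  have hi' : IndepFun (fun ω ↦ U ω + σ ^ 2) V P :=
    hi.comp (measurable_id.add_const (σ ^ 2)) measurable_id
  have hg : Measurable fun p : ℝ × E ↦ p.2 + ((σ ^ 2)⁻¹ * p.1) • h :=
    hE.measurable_iff.2 fun t ↦ by
      have : Measurable fun a : ℝ × E ↦ ev a.2 t := (hE.measurable_eval t).comp measurable_snd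
      simp only [map_add, map_smul, Pi.add_apply, Pi.smul_apply, smul_eq_mul]
      refine Measurable.add this (by fun_prop)
  have key := tvDist_map_prod_le hU (hU.add_const (σ ^ 2)) hVm hi hi' hg
  have e1 : (fun ω ↦ V ω + ((σ ^ 2)⁻¹ * U ω) • h) = path := by
    ext ω; simp [hV]
  have e2 : (fun ω ↦ V ω + ((σ ^ 2)⁻¹ * (U ω + σ ^ 2)) • h) = fun ω ↦ path ω + h := by
    ext ω
    rw [mul_add, inv_mul_cancel₀ (by positivity), add_smul, one_smul]
    simp [hV]
    abel
  simp only [e1, e2] at key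
  refine key.trans ?_
  -- Both laws are images under multiplication by `σ`, of `N(0, 1)` and of `N(σ, 1)`; this is where
  -- the standard deviation enters the bound.
  have e3 : P.map U = (gaussianReal 0 1).map (σ * ·) := by
    rw [hlaw, gaussianReal_map_const_mul]
    congr 1
    · simp
    · ext; simp [hσ2, hpos.le]
  have e4 : P.map (fun ω ↦ U ω + σ ^ 2) = (gaussianReal σ 1).map (σ * ·) := by
    have : P.map (fun ω ↦ U ω + σ ^ 2) = (P.map U).map (· + σ ^ 2) :=
      (Measure.map_map (g := (· + σ ^ 2)) (by fun_prop) hU).symm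
    rw [this, hlaw, gaussianReal_map_add_const, gaussianReal_map_const_mul]
    congr 1
    · ring
    · ext; simp [hσ2, hpos.le]
  rw [e3, e4]
  refine (tvDist_map_le _ _ (by fun_prop)).trans ((tvDist_gaussianReal_le σ).trans ?_)
  rw [abs_of_pos hσ0]

end IsPathSpace

/-- Centered Gaussian vectors with the same covariance matrix have the same law. -/
theorem map_eq_of_covariance_eq {Ω' ι : Type*} [MeasurableSpace Ω'] {P' : Measure Ω'} [Fintype ι]
    {X : ι → Ω → ℝ} {Y : ι → Ω' → ℝ} (hX : HasGaussianLaw (fun ω i ↦ X i ω) P)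
    (hY : HasGaussianLaw (fun ω i ↦ Y i ω) P') (hX0 : ∀ i, P[X i] = 0) (hY0 : ∀ i, P'[Y i] = 0)
    (hc : ∀ i j, cov[X i, X j; P] = cov[Y i, Y j; P']) :
    P.map (fun ω i ↦ X i ω) = P'.map (fun ω i ↦ Y i ω) := by
  classical
  have := hX.isProbabilityMeasure
  have := hY.isProbabilityMeasure
  have := hX.isGaussian_map
  have := hY.isGaussian_map
  refine Measure.ext_of_charFunDual (funext fun L ↦ ?_)
  rw [hX.charFunDual_map_eq_fun, hY.charFunDual_map_eq_fun]
  have hL : ∀ x : ι → ℝ, L x = ∑ i, L (Pi.single i 1) * x i := fun x ↦ by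
    conv_lhs => rw [pi_eq_sum_univ' x]
    simp [mul_comm]
  have hXL : ∀ i, MemLp (X i) 2 P := fun i ↦ (hX.eval i).memLp_two
  have hYL : ∀ i, MemLp (Y i) 2 P' := fun i ↦ (hY.eval i).memLp_two
  have hLX : (fun ω ↦ L fun i ↦ X i ω) = fun ω ↦ ∑ i, L (Pi.single i 1) * X i ω :=
    funext fun ω ↦ hL _
  have hLY : (fun ω ↦ L fun i ↦ Y i ω) = fun ω ↦ ∑ i, L (Pi.single i 1) * Y i ω :=
    funext fun ω ↦ hL _
  rw [hLX, hLY]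
  congr 3
  · congr 1
    rw [integral_finsetSum _ fun i _ ↦ ((hXL i).integrable one_le_two).const_mul _,
      integral_finsetSum _ fun i _ ↦ ((hYL i).integrable one_le_two).const_mul _]
    simp_rw [integral_const_mul, hX0, hY0]
  · congr 1
    rw [variance_fun_sum fun i ↦ (hXL i).const_mul _, variance_fun_sum fun i ↦ (hYL i).const_mul _]
    simp_rw [covariance_const_mul_left, covariance_const_mul_right, hc]

end GaussianProcess

/-! ### Shifts of fractional Brownian motion by elements of its reproducing kernel Hilbert space -/

section CameronMartin

/-- Evaluation at a countable dense set is a continuous injection of a Polish space, hence a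
measurable embedding by Lusin–Souslin. So countably many evaluations already generate the Borel
σ-algebra. -/
theorem isPathSpace_continuousMap :
    IsPathSpace (ContinuousMap.coeFnLinearMap ℝ : C(unitInterval, ℝ) →ₗ[ℝ] _) where
  injective := DFunLike.coe_injective
  comap_eq := by
    refine le_antisymm ?_ ?_
    · obtain ⟨D, hDc, hD⟩ := TopologicalSpace.exists_countable_dense unitInterval
      have := hDc.to_subtype
      let ρ : C(unitInterval, ℝ) → (D → ℝ) := fun f d ↦ f d
      have hρm : Measurable ρ := measurable_pi_iff.2 fun d ↦
        (ContinuousEvalConst.continuous_eval_const (d : unitInterval)).measurable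
      have hρi : Function.Injective ρ := fun f g h ↦ by
        refine DFunLike.coe_injective (Continuous.ext_on hD f.continuous g.continuous fun d hd ↦ ?_)
        exact congrFun h ⟨d, hd⟩
      rw [← (hρm.measurableEmbedding hρi).comap_eq]
      have e : ρ = (fun (x : unitInterval → ℝ) (d : D) ↦ x d) ∘
          (ContinuousMap.coeFnLinearMap ℝ : C(unitInterval, ℝ) →ₗ[ℝ] _) := rfl
      rw [e, ← MeasurableSpace.comap_comp]
      refine MeasurableSpace.comap_mono ?_
      exact (measurable_pi_iff.2 fun d ↦ measurable_pi_apply _ : Measurable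
        fun (x : unitInterval → ℝ) (d : D) ↦ x d).comap_le
    · refine Measurable.comap_le (measurable_pi_iff.2 fun t ↦ ?_)
      exact (ContinuousEvalConst.continuous_eval_const t).measurable

theorem continuous_fbmCov {H : ℝ} (hH : H ∈ Set.Ioo (0 : ℝ) 1) (s : ℝ) :
    Continuous fun t ↦ fbmCov H t s := by
  have h : 0 ≤ 2 * H := by linarith [hH.1]
  unfold fbmCov
  refine ((continuous_const.add (continuous_abs.rpow_const fun _ ↦ .inr h)).sub ?_).div_const 2
  exact (continuous_const.sub continuous_id).abs.rpow_const fun _ ↦ .inr h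

theorem IsFractionalBrownianMotion.measurable_path {Ω : Type*} [MeasurableSpace Ω] {H : ℝ}
    {B : ℝ≥0 → Ω → ℝ} {P : Measure Ω} (hB : IsFractionalBrownianMotion H B P) :
    Measurable hB.path :=
  isPathSpace_continuousMap.measurable_iff.2 fun t ↦ hB.measurable ⟨t, t.2.1⟩

variable {H : ℝ} [Fact (fbmKernel H).PosSemidef]

/-- The kernel function at `t` in the reproducing kernel Hilbert space of fractional Brownian
motion. -/
noncomputable def fbmKer (H : ℝ) [Fact (fbmKernel H).PosSemidef] (t : unitInterval) :
    RKHS.OfKernel (fbmKernel H) :=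
  RKHS.kerFun (RKHS.OfKernel (fbmKernel H)) t 1

theorem inner_fbmKer (t : unitInterval) (φ : RKHS.OfKernel (fbmKernel H)) :
    inner ℝ (fbmKer H t) φ = φ t := by
  simp [fbmKer]

theorem fbmKer_apply (s t : unitInterval) : fbmKer H s t = fbmCov H t s := by
  rw [fbmKer, RKHS.kerFun_apply, RKHS.OfKernel.kernel_ofKernel]
  simp [fbmKernel]

theorem norm_fbmKer_le (hH : 0 < H) (t : unitInterval) : ‖fbmKer H t‖ ≤ 1 := by
  have h : ‖fbmKer H t‖ ^ 2 = fbmCov H t t := by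
    rw [← real_inner_self_eq_norm_sq, inner_fbmKer, fbmKer_apply]
  have h1 : fbmCov H t t ≤ 1 := by
    have : |(t : ℝ)| ^ (2 * H) ≤ 1 :=
      Real.rpow_le_one (abs_nonneg _) (by rw [abs_of_nonneg t.2.1]; exact t.2.2) (by positivity)
    simpa [fbmCov, Real.zero_rpow (by positivity : 2 * H ≠ 0)] using this
  nlinarith [norm_nonneg (fbmKer H t)]

/-- By the reproducing property and Cauchy–Schwarz. Approximation in the Hilbert space is thus
uniform approximation of paths. -/
theorem abs_apply_le_norm (hH : 0 < H) (φ : RKHS.OfKernel (fbmKernel H)) (t : unitInterval) :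
    |φ t| ≤ ‖φ‖ := by
  rw [← inner_fbmKer]
  exact (abs_real_inner_le_norm _ _).trans
    (mul_le_of_le_one_left (norm_nonneg _) (norm_fbmKer_le hH t))

theorem dense_span_fbmKer : Dense (Submodule.span ℝ (Set.range (fbmKer H)) :
    Set (RKHS.OfKernel (fbmKernel H))) := by
  rw [Submodule.dense_iff_topologicalClosure_eq_top, eq_top_iff,
    ← RKHS.kerFun_dense (𝕜 := ℝ) (RKHS.OfKernel (fbmKernel H))]
  refine Submodule.topologicalClosure_mono (Submodule.span_le.2 ?_)
  rintro _ ⟨x, v, rfl⟩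
  have : RKHS.kerFun (RKHS.OfKernel (fbmKernel H)) x v = v • fbmKer H x := by
    rw [fbmKer, ← map_smul, smul_eq_mul, mul_one]
  rw [this]
  exact Submodule.smul_mem _ _ (Submodule.subset_span ⟨x, rfl⟩)

namespace IsFractionalBrownianMotion

variable {Ω : Type*} [MeasurableSpace Ω] {B : ℝ≥0 → Ω → ℝ} {P : Measure Ω}

/-- A finite combination `∑ c i • fbmKer H i` is the covariance function of `U = ∑ c i B i`, and its
squared norm is `Var[U]`: this is the isometry between the Hilbert space and the Gaussian space of
the process. -/
theorem tvDist_map_path_add_le_of_mem_span (hB : IsFractionalBrownianMotion H B P)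
    {φ : RKHS.OfKernel (fbmKernel H)} (hφ : φ ∈ Submodule.span ℝ (Set.range (fbmKer H)))
    {h : C(unitInterval, ℝ)} (hh : ⇑φ = h) :
    tvDist (P.map hB.path) (P.map fun ω ↦ hB.path ω + h) ≤ ENNReal.ofReal (2 * ‖φ‖) := by
  obtain ⟨c, rfl⟩ := Finsupp.mem_span_range_iff_exists_finsupp.1 hφ
  set X : unitInterval → Ω → ℝ := fun t ↦ B ⟨t, t.2.1⟩
  have hX : IsGaussianProcess X P :=
    hB.isGaussianProcess.comp_right fun t : unitInterval ↦ (⟨t, t.2.1⟩ : ℝ≥0)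
  have := hX.isProbabilityMeasure
  have hXL : ∀ t, MemLp (X t) 2 P := fun t ↦ (hX.hasGaussianLaw_eval t).memLp_two
  have hXm : ∀ t, Measurable (X t) := fun t ↦ hB.measurable _
  have hcov : ∀ s t, cov[X s, X t; P] = fbmCov H s t := fun s t ↦ hB.covariance_eq _ _
  set U : Ω → ℝ := fun ω ↦ ∑ i ∈ c.support, c i * X i ω with hU
  have hXU : ∀ t, cov[X t, U; P] = ∑ i ∈ c.support, c i * fbmCov H t i := fun t ↦ by
    rw [hU, covariance_fun_sum_right' (fun i _ ↦ (hXL i).const_mul _) (hXL t)]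
    simp_rw [covariance_const_mul_right, hcov]
  have hφt : ∀ t, (c.sum fun i a ↦ a • fbmKer H i) t = ∑ i ∈ c.support, c i * fbmCov H t i :=
    fun t ↦ by
      rw [← inner_fbmKer, Finsupp.sum, inner_sum]
      simp_rw [inner_smul_right, inner_fbmKer, fbmKer_apply]
  have hvar : Var[U; P] = ‖c.sum fun i a ↦ a • fbmKer H i‖ ^ 2 := by
    rw [← covariance_self (by fun_prop), ← real_inner_self_eq_norm_sq]
    conv_rhs => rw [Finsupp.sum, sum_inner]
    conv_lhs => rw [hU, covariance_fun_sum_left' (fun i _ ↦ (hXL i).const_mul _)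
      (memLp_finsetSum _ fun i _ ↦ (hXL i).const_mul _)]
    refine Finset.sum_congr rfl fun i _ ↦ ?_
    rw [covariance_const_mul_left, ← hU, hXU, real_inner_smul_left, inner_fbmKer]
    exact congrArg _ (hφt i).symm
  have key := isPathSpace_continuousMap.tvDist_map_add_le (P := P) (U := U) (X := X)
    (isGaussianProcess_of_mem_span hX ?_) (by fun_prop) ?_ hXm (path := hB.path)
    (fun _ _ ↦ rfl) (h := h) ?_
  · rwa [hvar, Real.sqrt_sq (norm_nonneg _)] at key
  · rintro (_ | t)
    · have : U = ∑ i ∈ c.support, c i • X i := by ext ω; simp [hU]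
      simp only [Sum.elim_inl, this]
      exact sum_mem fun i _ ↦ Submodule.smul_mem _ _ (Submodule.subset_span ⟨i, rfl⟩)
    · exact Submodule.subset_span ⟨t, rfl⟩
  · rw [hU, integral_finsetSum _ fun i _ ↦ ((hXL i).integrable one_le_two).const_mul _]
    refine Finset.sum_eq_zero fun i _ ↦ ?_
    rw [integral_const_mul]
    exact mul_eq_zero_of_right _ (hB.mean_eq_zero _)
  · intro t
    rw [hXU, ← hφt, hh]
    rfl

/-- The Cameron-Martin shift estimate for fractional Brownian motion. -/
theorem tvDist_map_path_add_le (hH : H ∈ Set.Ioo (0 : ℝ) 1)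
    (hB : IsFractionalBrownianMotion H B P)
    {φ : RKHS.OfKernel (fbmKernel H)} {h : C(unitInterval, ℝ)} (hh : ⇑φ = h) :
    tvDist (P.map hB.path) (P.map fun ω ↦ hB.path ω + h) ≤ ENNReal.ofReal (2 * ‖φ‖) := by
  have := hB.isGaussianProcess.isProbabilityMeasure
  have hp := hB.measurable_path
  have hps : ∀ h : C(unitInterval, ℝ), Measurable fun ω ↦ hB.path ω + h := fun h ↦
    ((continuous_id.add continuous_const).measurable.comp hp :
      Measurable ((fun x : C(unitInterval, ℝ) ↦ x + h) ∘ hB.path))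
  have := Measure.isProbabilityMeasure_map (μ := P) hp.aemeasurable
  have := fun h ↦ Measure.isProbabilityMeasure_map (μ := P) (hps h).aemeasurable
  have hclosed : ∀ A : Set C(unitInterval, ℝ), IsClosed A →
      P.map (fun ω ↦ hB.path ω + h) A ≤ P.map hB.path A + ENNReal.ofReal (2 * ‖φ‖) := by
    intro A hA
    -- Replace `φ` by a finite combination `ψ` at distance less than `ε`. The two shifts differ by
    -- at most `ε` uniformly, which enlarging `A` to its `ε`-thickening absorbs. As `ε → 0` the
    -- thickenings of a closed set decrease to it in measure.
    have hε : ∀ ε > 0, P.map (fun ω ↦ hB.path ω + h) A ≤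
        P.map hB.path (Metric.cthickening ε A) + ENNReal.ofReal (2 * (‖φ‖ + ε)) := by
      intro ε hε
      obtain ⟨ψ, hψ, hd⟩ := Metric.mem_closure_iff.1 (dense_span_fbmKer φ) ε hε
      have hcont : Continuous ⇑ψ := by
        obtain ⟨c, rfl⟩ := Finsupp.mem_span_range_iff_exists_finsupp.1 hψ
        have : ⇑(c.sum fun i a ↦ a • fbmKer H i) =
            fun t : unitInterval ↦ ∑ i ∈ c.support, c i * fbmCov H t i := by
          ext t
          rw [← inner_fbmKer, Finsupp.sum, inner_sum]
          simp_rw [inner_smul_right, inner_fbmKer, fbmKer_apply]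
        rw [this]
        exact continuous_finsetSum _ fun i _ ↦ continuous_const.mul
          ((continuous_fbmCov hH i).comp continuous_subtype_val)
      let h' : C(unitInterval, ℝ) := ⟨ψ, hcont⟩
      have hdist : dist h h' ≤ ε := by
        refine (ContinuousMap.dist_le hε.le).2 fun t ↦ ?_
        have e : h t - h' t = (φ - ψ) t := by
          rw [RKHS.coe_sub, Pi.sub_apply, hh]; rfl
        rw [Real.dist_eq, e]
        exact (abs_apply_le_norm hH.1 _ t).trans (by rw [← dist_eq_norm]; exact hd.le)
      have hψφ : ‖ψ‖ ≤ ‖φ‖ + ε := by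
        have := norm_sub_norm_le ψ φ
        rw [← dist_eq_norm, dist_comm] at this
        linarith
      calc P.map (fun ω ↦ hB.path ω + h) A
          ≤ P.map (fun ω ↦ hB.path ω + h') (Metric.cthickening ε A) := by
            rw [Measure.map_apply (hps h) hA.measurableSet,
              Measure.map_apply (hps h') Metric.isClosed_cthickening.measurableSet]
            refine measure_mono fun ω hω ↦ ?_
            refine Metric.mem_cthickening_of_dist_le _ _ ε _ hω ?_
            rwa [dist_add_left, dist_comm]
        _ ≤ P.map hB.path (Metric.cthickening ε A) + ENNReal.ofReal (2 * ‖ψ‖) := by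
            refine (measure_le_add_tvDist _ (P.map hB.path)
              Metric.isClosed_cthickening.measurableSet).trans (add_le_add_right ?_ _)
            rw [tvDist_comm]
            exact hB.tvDist_map_path_add_le_of_mem_span hψ (h := h') rfl
        _ ≤ _ := by gcongr
    have hlim : Tendsto (fun ε ↦ P.map hB.path (Metric.cthickening ε A) +
        ENNReal.ofReal (2 * (‖φ‖ + ε))) (𝓝[>] 0)
        (𝓝 (P.map hB.path A + ENNReal.ofReal (2 * (‖φ‖ + 0)))) := by
      refine Tendsto.add ?_ ?_
      · exact (tendsto_measure_cthickening_of_isClosed ⟨1, one_pos, measure_ne_top _ _⟩ hA).mono_left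
          nhdsWithin_le_nhds
      · refine ENNReal.tendsto_ofReal (Tendsto.mono_left ?_ nhdsWithin_le_nhds)
        exact (Continuous.tendsto (by fun_prop) 0)
    rw [add_zero] at hlim
    exact ge_of_tendsto hlim (eventually_nhdsWithin_of_forall fun ε hε' ↦ hε ε hε')
  rw [tvDist_comm]
  refine tvDist_le_of_forall_measure_le fun A hA ↦ ?_
  refine ENNReal.le_of_forall_pos_le_add fun ε hε _ ↦ ?_
  -- Inner regularity passes from closed sets to all Borel sets.
  obtain ⟨F, hFA, hF, hlt⟩ := hA.exists_isClosed_lt_add (μ := P.map fun ω ↦ hB.path ω + h)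
    (measure_ne_top _ _) (ENNReal.coe_ne_zero.2 hε.ne')
  refine hlt.le.trans (add_le_add_left ((hclosed F hF).trans ?_) _)
  gcongr

theorem tvDist_map_add_smul_path_le (hH : H ∈ Set.Ioo (0 : ℝ) 1)
    (hB : IsFractionalBrownianMotion H B P) {φ : RKHS.OfKernel (fbmKernel H)}
    {F G : C(unitInterval, ℝ)} (hφ : ⇑φ = G - F) {c : ℝ} (hc : 0 < c) :
    tvDist (P.map fun ω ↦ F + c • hB.path ω) (P.map fun ω ↦ G + c • hB.path ω) ≤
      ENNReal.ofReal (2 * (c⁻¹ * ‖φ‖)) := by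
  have := hB.isGaussianProcess.isProbabilityMeasure
  have hp := hB.measurable_path
  have hps : Measurable fun ω ↦ hB.path ω + c⁻¹ • (G - F) :=
    ((continuous_id.add continuous_const).measurable.comp hp :
      Measurable ((fun x : C(unitInterval, ℝ) ↦ x + c⁻¹ • (G - F)) ∘ hB.path))
  have := Measure.isProbabilityMeasure_map (μ := P) hp.aemeasurable
  have := Measure.isProbabilityMeasure_map (μ := P) hps.aemeasurable
  have hg : Measurable fun x : C(unitInterval, ℝ) ↦ F + c • x :=
    (continuous_const.add (continuous_id.const_smul c)).measurable
  have key := (tvDist_map_le _ _ hg).trans (hB.tvDist_map_path_add_le hH (φ := c⁻¹ • φ)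
    (h := c⁻¹ • (G - F)) (by rw [RKHS.coe_smul, hφ]; rfl))
  rw [Measure.map_map hg hp, Measure.map_map hg hps, norm_smul, Real.norm_of_nonneg
    (inv_nonneg.2 hc.le)] at key
  have e : ((fun x ↦ F + c • x) ∘ fun ω ↦ hB.path ω + c⁻¹ • (G - F)) =
      fun ω ↦ G + c • hB.path ω := by
    ext1 ω
    simp only [Function.comp_apply, smul_add, smul_smul, mul_inv_cancel₀ hc.ne', one_smul]
    abel
  rwa [e] at key

end IsFractionalBrownianMotion

end CameronMartin

/-! ### The smallest eigenvalue of the covariance matrix of fractional Gaussian noise -/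

section FractionalGaussianNoise

/-- The autocovariance function of fractional Gaussian noise. -/
noncomputable def fgnCov (H d : ℝ) : ℝ :=
  (|d + 1| ^ (2 * H) - 2 * |d| ^ (2 * H) + |d - 1| ^ (2 * H)) / 2

/-- The right side is the covariance of the unit increments of fractional Brownian motion starting
at `s` and `t`, expanded bilinearly. -/
theorem fgnCov_eq_fbmCov (H s t : ℝ) :
    fgnCov H (s - t) = fbmCov H (s + 1) (t + 1) - fbmCov H (s + 1) t - fbmCov H s (t + 1) +
      fbmCov H s t := by
  simp only [fgnCov, fbmCov]
  rw [show t + 1 - (s + 1) = -(s - t) by ring, show t - (s + 1) = -(s - t + 1) by ring,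
    show t + 1 - s = -(s - t - 1) by ring, show t - s = -(s - t) by ring]
  simp only [abs_neg]
  ring

variable {H : ℝ}

/-- The function `(1 - cos x) cos (d x)` is half the second difference in `d` of `1 - cos (d x)`,
just as `fgnCov` is half the second difference of `|d| ^ (2 * H)`. -/
theorem integrableOn_fgnCov_density (hH : H ∈ Set.Ioo (0 : ℝ) 1) (d : ℝ) :
    IntegrableOn (fun x : ℝ ↦ (1 - Real.cos x) * Real.cos (d * x) * x ^ (-1 - 2 * H))
      (Set.Ioi 0) := by
  have h := integrableOn_one_sub_cos_mul_rpow hH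
  refine ((((h (d + 1)).add (h (d - 1))).sub ((h d).const_mul 2)).div_const 2).congr
    (ae_of_all _ fun x ↦ ?_)
  simp only [Pi.add_apply, Pi.sub_apply, add_mul, sub_mul, one_mul, Real.cos_add, Real.cos_sub]
  ring

/-- The spectral representation of the autocovariance of fractional Gaussian noise. -/
theorem mul_fgnCov_eq_integral (hH : H ∈ Set.Ioo (0 : ℝ) 1) (d : ℝ) :
    (∫ x in Set.Ioi (0 : ℝ), (1 - Real.cos x) * x ^ (-1 - 2 * H)) * fgnCov H d =
      ∫ x in Set.Ioi (0 : ℝ), (1 - Real.cos x) * Real.cos (d * x) * x ^ (-1 - 2 * H) := by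
  set C := ∫ x in Set.Ioi (0 : ℝ), (1 - Real.cos x) * x ^ (-1 - 2 * H) with hC
  have h := integrableOn_one_sub_cos_mul_rpow hH
  have e : C * fgnCov H d = (|d + 1| ^ (2 * H) * C + |d - 1| ^ (2 * H) * C
      - 2 * (|d| ^ (2 * H) * C)) / 2 := by unfold fgnCov; ring
  rw [e, hC, ← integral_one_sub_cos_mul_rpow hH, ← integral_one_sub_cos_mul_rpow hH,
    ← integral_one_sub_cos_mul_rpow hH, ← integral_add (h _) (h _), ← integral_const_mul,
    ← integral_sub (f := fun x : ℝ ↦ (1 - Real.cos ((d + 1) * x)) * x ^ (-1 - 2 * H)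
      + (1 - Real.cos ((d - 1) * x)) * x ^ (-1 - 2 * H)) ((h _).add (h _)) ((h d).const_mul 2),
    ← integral_div]
  refine integral_congr_ae (ae_of_all _ fun x ↦ ?_)
  simp only [add_mul, sub_mul, one_mul, Real.cos_add, Real.cos_sub]
  ring

theorem integral_cos_int_mul (k : ℤ) :
    ∫ x in (0 : ℝ)..Real.pi, Real.cos (k * x) = if k = 0 then Real.pi else 0 := by
  split_ifs with hk
  · simp [hk]
  · have hk' : (k : ℝ) ≠ 0 := Int.cast_ne_zero.2 hk
    rw [intervalIntegral.integral_comp_mul_left _ hk']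
    simp [Real.sin_int_mul_pi]

/-- The squared modulus of the trigonometric polynomial with coefficients `c`. -/
theorem sum_sum_mul_cos_sub_eq {n : ℕ} (c : Fin n → ℝ) (x : ℝ) :
    ∑ i, ∑ j, c i * c j * Real.cos (((i : ℝ) - j) * x) =
      (∑ i, c i * Real.cos (i * x)) ^ 2 + (∑ i, c i * Real.sin (i * x)) ^ 2 := by
  rw [sq, sq, Finset.sum_mul_sum, Finset.sum_mul_sum, ← Finset.sum_add_distrib]
  refine Finset.sum_congr rfl fun i _ ↦ ?_
  rw [← Finset.sum_add_distrib]
  refine Finset.sum_congr rfl fun j _ ↦ ?_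
  rw [sub_mul, Real.cos_sub]
  ring

theorem sum_sum_mul_cos_sub_le {n : ℕ} (c : Fin n → ℝ) (x : ℝ) :
    ∑ i, ∑ j, c i * c j * Real.cos (((i : ℝ) - j) * x) ≤ n * ∑ i, c i ^ 2 := by
  rw [sum_sum_mul_cos_sub_eq]
  have h1 := Finset.sum_mul_sq_le_sq_mul_sq Finset.univ c fun i ↦ Real.cos (i * x)
  have h2 := Finset.sum_mul_sq_le_sq_mul_sq Finset.univ c fun i ↦ Real.sin (i * x)
  refine (add_le_add h1 h2).trans_eq ?_
  rw [← mul_add, ← Finset.sum_add_distrib]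
  simp [Real.cos_sq_add_sin_sq, mul_comm]

/-- Parseval's identity on the half period: only the diagonal terms survive. -/
theorem integral_sum_sum_mul_cos_sub {n : ℕ} (c : Fin n → ℝ) :
    ∫ x in (0 : ℝ)..Real.pi, ∑ i, ∑ j, c i * c j * Real.cos (((i : ℝ) - j) * x) =
      Real.pi * ∑ i, c i ^ 2 := by
  have hi : ∀ i j : Fin n, IntervalIntegrable
      (fun x ↦ c i * c j * Real.cos (((i : ℝ) - j) * x)) volume 0 Real.pi := fun i j ↦
    Continuous.intervalIntegrable (by fun_prop) _ _
  rw [intervalIntegral.integral_finsetSum fun i _ ↦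
    Continuous.intervalIntegrable (by fun_prop) _ _, Finset.mul_sum]
  refine Finset.sum_congr rfl fun i _ ↦ ?_
  rw [intervalIntegral.integral_finsetSum fun j _ ↦ hi i j]
  have : ∀ j : Fin n, ∫ x in (0 : ℝ)..Real.pi, c i * c j * Real.cos (((i : ℝ) - j) * x) =
      if i = j then Real.pi * c i ^ 2 else 0 := fun j ↦ by
    rw [intervalIntegral.integral_const_mul]
    have := integral_cos_int_mul ((i : ℤ) - (j : ℤ))
    push_cast at this
    rw [this]
    by_cases hij : i = j
    · simp [hij]; ring
    · have : ¬((i : ℤ) - (j : ℤ) = 0) := fun h ↦ hij (Fin.ext (by omega))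
      simp [hij, this]
  simp [this]

/-- On `[1 / n, π]` the power `x ^ (1 - 2 * H)` is smallest at `1 / n` if `H ≤ 1 / 2`, which
produces the factor `n ^ (1 - 2 * H)`. If `H ≥ 1 / 2` it is smallest at `π`, where it is at least `1
/ π` because `1 - 2 * H > -1`. -/
theorem one_le_max_rpow_mul_rpow (hH : H ∈ Set.Ioo (0 : ℝ) 1) {n : ℕ} {x : ℝ}
    (hn : 0 < n) (h1 : (n : ℝ)⁻¹ ≤ x) (h2 : x ≤ Real.pi) :
    1 ≤ max ((n : ℝ) ^ (1 - 2 * H)) 1 * (Real.pi * x ^ (1 - 2 * H)) := by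
  have hn' : (0 : ℝ) < n := Nat.cast_pos.2 hn
  have hx : 0 < x := (inv_pos.2 hn').trans_le h1
  have hpi : 1 ≤ Real.pi := by linarith [Real.pi_gt_three]
  rcases le_total 0 (1 - 2 * H) with h | h
  · have h3 : 1 ≤ (n : ℝ) ^ (1 - 2 * H) * x ^ (1 - 2 * H) := by
      rw [← Real.mul_rpow hn'.le hx.le]
      refine Real.one_le_rpow ?_ h
      rwa [inv_le_iff_one_le_mul₀ hn', mul_comm] at h1
    calc (1 : ℝ) ≤ (n : ℝ) ^ (1 - 2 * H) * x ^ (1 - 2 * H) := h3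
      _ ≤ max ((n : ℝ) ^ (1 - 2 * H)) 1 * (Real.pi * x ^ (1 - 2 * H)) := by
        gcongr
        · exact le_max_left _ _
        · exact le_mul_of_one_le_left (by positivity) hpi
  · have h3 : Real.pi⁻¹ ≤ x ^ (1 - 2 * H) := by
      calc Real.pi⁻¹ = Real.pi ^ (-1 : ℝ) := by rw [Real.rpow_neg_one]
        _ ≤ Real.pi ^ (1 - 2 * H) := Real.rpow_le_rpow_of_exponent_le hpi (by linarith [hH.2])
        _ ≤ x ^ (1 - 2 * H) := Real.rpow_le_rpow_of_nonpos hx h2 h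
    calc (1 : ℝ) = 1 * (Real.pi * Real.pi⁻¹) := by field_simp
      _ ≤ max ((n : ℝ) ^ (1 - 2 * H)) 1 * (Real.pi * x ^ (1 - 2 * H)) := by
        gcongr
        exact le_max_right _ _

/-- The smallest eigenvalue of the covariance matrix of `n` consecutive fractional Gaussian noise
variables is at least of order `min (n ^ (2 * H - 1)) 1`. -/
theorem exists_pos_mul_sum_sq_le (hH : H ∈ Set.Ioo (0 : ℝ) 1) :
    ∃ a : ℝ, 0 < a ∧ ∀ n : ℕ, 0 < n → ∀ c : Fin n → ℝ,
      a * ∑ i, c i ^ 2 ≤ max ((n : ℝ) ^ (1 - 2 * H)) 1 *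
        ∑ i, ∑ j, c i * c j * fgnCov H ((i : ℝ) - j) := by
  set C := ∫ x in Set.Ioi (0 : ℝ), (1 - Real.cos x) * x ^ (-1 - 2 * H) with hC
  have hCpos : 0 < C := integral_one_sub_cos_mul_rpow_pos hH
  have hpi := Real.pi_gt_three
  refine ⟨2 / Real.pi ^ 3 / C, by positivity, fun n hn c ↦ ?_⟩
  have hn' : (0 : ℝ) < n := Nat.cast_pos.2 hn
  set M := max ((n : ℝ) ^ (1 - 2 * H)) 1 with hM
  have hMpos : 0 < M := lt_max_of_lt_right one_pos
  set q : ℝ → ℝ := fun x ↦ ∑ i, ∑ j, c i * c j * Real.cos (((i : ℝ) - j) * x) with hq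
  have hqc : Continuous q := by fun_prop
  have hq0 : ∀ x, 0 ≤ q x := fun x ↦ by
    simp only [hq, sum_sum_mul_cos_sub_eq]
    positivity
  have hn1 : (n : ℝ)⁻¹ ≤ 1 := inv_le_one_of_one_le₀ (by exact_mod_cast hn)
  have hint : IntegrableOn (fun x ↦ (1 - Real.cos x) * q x * x ^ (-1 - 2 * H)) (Set.Ioi 0) := by
    have : (fun x ↦ (1 - Real.cos x) * q x * x ^ (-1 - 2 * H)) = fun x ↦ ∑ i, ∑ j,
        c i * c j * ((1 - Real.cos x) * Real.cos (((i : ℝ) - j) * x) * x ^ (-1 - 2 * H)) := by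
      ext x
      simp only [hq, Finset.mul_sum, Finset.sum_mul]
      refine Finset.sum_congr rfl fun i _ ↦ Finset.sum_congr rfl fun j _ ↦ by ring
    rw [this]
    exact integrable_finsetSum _ fun i _ ↦ integrable_finsetSum _ fun j _ ↦
      (integrableOn_fgnCov_density hH _).const_mul _
  have hCQ : C * ∑ i, ∑ j, c i * c j * fgnCov H ((i : ℝ) - j) =
      ∫ x in Set.Ioi (0 : ℝ), (1 - Real.cos x) * q x * x ^ (-1 - 2 * H) := by
    have : ∀ x, (1 - Real.cos x) * q x * x ^ (-1 - 2 * H) = ∑ i, ∑ j,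
        c i * c j * ((1 - Real.cos x) * Real.cos (((i : ℝ) - j) * x) * x ^ (-1 - 2 * H)) := by
      intro x
      simp only [hq, Finset.mul_sum, Finset.sum_mul]
      refine Finset.sum_congr rfl fun i _ ↦ Finset.sum_congr rfl fun j _ ↦ by ring
    simp_rw [this]
    rw [integral_finsetSum _ fun i _ ↦ integrable_finsetSum _ fun j _ ↦
      (integrableOn_fgnCov_density hH _).const_mul _, Finset.mul_sum]
    refine Finset.sum_congr rfl fun i _ ↦ ?_
    rw [integral_finsetSum _ fun j _ ↦ (integrableOn_fgnCov_density hH _).const_mul _,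
      Finset.mul_sum]
    refine Finset.sum_congr rfl fun j _ ↦ ?_
    rw [integral_const_mul, ← mul_fgnCov_eq_integral hH]
    ring
  -- By Cauchy–Schwarz `q ≤ n ∑ c i ^ 2`, so `[0, 1 / n]` carries at most `∑ c i ^ 2` out of `π ∑ c
  -- i ^ 2`, and `π - 1 ≥ 2`.
  have hqlow : 2 * ∑ i, c i ^ 2 ≤ ∫ x in (n : ℝ)⁻¹..Real.pi, q x := by
    have h1 := intervalIntegral.integral_add_adjacent_intervals
      (hqc.intervalIntegrable (μ := volume) 0 (n : ℝ)⁻¹)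
      (hqc.intervalIntegrable (n : ℝ)⁻¹ Real.pi)
    rw [integral_sum_sum_mul_cos_sub] at h1
    have h2 : ∫ x in (0 : ℝ)..(n : ℝ)⁻¹, q x ≤ ∑ i, c i ^ 2 := by
      calc ∫ x in (0 : ℝ)..(n : ℝ)⁻¹, q x ≤ ∫ x in (0 : ℝ)..(n : ℝ)⁻¹, n * ∑ i, c i ^ 2 :=
            intervalIntegral.integral_mono_on (inv_nonneg.2 hn'.le) (hqc.intervalIntegrable _ _)
              intervalIntegrable_const fun x _ ↦ sum_sum_mul_cos_sub_le c x
        _ = _ := by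
          rw [intervalIntegral.integral_const]
          simp [hn'.ne']
    have h3 : 0 ≤ ∑ i, c i ^ 2 := by positivity
    nlinarith
  have hsub : Set.Ioc (n : ℝ)⁻¹ Real.pi ⊆ Set.Ioi 0 := fun x hx ↦ (inv_pos.2 hn').trans hx.1
  -- Away from the origin the spectral weight is bounded below: `1 - cos x ≥ (2 / π²) x²` on `[0,
  -- π]` leaves `x ^ (1 - 2 * H)`, and `M` times this is at least `1 / π`.
  have hlow : 2 / Real.pi ^ 3 * ∫ x in (n : ℝ)⁻¹..Real.pi, q x ≤
      M * ∫ x in Set.Ioi (0 : ℝ), (1 - Real.cos x) * q x * x ^ (-1 - 2 * H) := by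
    calc 2 / Real.pi ^ 3 * ∫ x in (n : ℝ)⁻¹..Real.pi, q x
        = ∫ x in Set.Ioc (n : ℝ)⁻¹ Real.pi, 2 / Real.pi ^ 3 * q x := by
          rw [intervalIntegral.integral_of_le (by linarith), integral_const_mul]
      _ ≤ ∫ x in Set.Ioc (n : ℝ)⁻¹ Real.pi,
            M * ((1 - Real.cos x) * q x * x ^ (-1 - 2 * H)) := by
          refine setIntegral_mono_on ?_ ((hint.mono_set hsub).const_mul M) measurableSet_Ioc
            fun x hx ↦ ?_
          · exact (Continuous.integrableOn_Ioc (by fun_prop))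
          have hx0 : 0 < x := hsub hx
          have hcos : 2 / Real.pi ^ 2 * x ^ 2 ≤ 1 - Real.cos x := by
            linarith [Real.cos_le_one_sub_mul_cos_sq (x := x) (by rw [abs_of_pos hx0]; exact hx.2)]
          have hm := one_le_max_rpow_mul_rpow hH hn hx.1.le hx.2
          have e : x ^ (1 - 2 * H) = x ^ 2 * x ^ (-1 - 2 * H) := by
            rw [← Real.rpow_natCast, ← Real.rpow_add hx0]; congr 1; push_cast; ring
          have hr := Real.rpow_nonneg hx0.le (-1 - 2 * H)
          calc 2 / Real.pi ^ 3 * q x ≤ 2 / Real.pi ^ 3 * q x * (M * (Real.pi * x ^ (1 - 2 * H))) :=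
                le_mul_of_one_le_right (mul_nonneg (by positivity) (hq0 x)) hm
            _ = M * (2 / Real.pi ^ 2 * x ^ 2 * q x * x ^ (-1 - 2 * H)) := by
                rw [e]; field_simp
            _ ≤ _ := by
                gcongr
                exact hq0 x
      _ = M * ∫ x in Set.Ioc (n : ℝ)⁻¹ Real.pi, (1 - Real.cos x) * q x * x ^ (-1 - 2 * H) :=
          integral_const_mul _ _
      _ ≤ _ := by
          refine mul_le_mul_of_nonneg_left (setIntegral_mono_set hint ?_
            hsub.eventuallyLE) hMpos.le
          refine (ae_restrict_iff' measurableSet_Ioi).2 (ae_of_all _ fun x hx ↦ ?_)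
          exact mul_nonneg (mul_nonneg (sub_nonneg.2 (Real.cos_le_one x)) (hq0 x))
            (Real.rpow_nonneg (le_of_lt hx) _)
  rw [← hCQ] at hlow
  have h4 : 0 ≤ ∑ i, c i ^ 2 := by positivity
  rw [div_mul_eq_mul_div, div_le_iff₀ hCpos]
  calc 2 / Real.pi ^ 3 * ∑ i, c i ^ 2 ≤ 2 / Real.pi ^ 3 * ∫ x in (n : ℝ)⁻¹..Real.pi, q x := by
        gcongr
        linarith
    _ ≤ _ := by linarith

end FractionalGaussianNoise

/-! ### Bounds for the deficiency -/

section Deficiency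

variable {ι X Y Z : Type*} [MeasurableSpace X] [MeasurableSpace Y] [MeasurableSpace Z]

theorem deficiency_le_iSup_tvDist_map (P : ι → Measure X) (Q : ι → Measure Y) {g : X → Y}
    (hg : Measurable g) : deficiency P Q ≤ ⨆ θ, tvDist ((P θ).map g) (Q θ) := by
  refine iInf₂_le_of_le (Kernel.deterministic g hg) inferInstance (le_of_eq ?_)
  simp_rw [Measure.deterministic_comp_eq_map]

/-- A randomization with an auxiliary variable of law `ρ` bounds the deficiency. -/
theorem deficiency_le_iSup_tvDist_prod_map (P : ι → Measure X) (Q : ι → Measure Y)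
    [∀ θ, SFinite (P θ)] (ρ : Measure Z) [IsProbabilityMeasure ρ] {g : X × Z → Y}
    (hg : Measurable g) :
    deficiency P Q ≤ ⨆ θ, tvDist (((P θ).prod ρ).map g) (Q θ) := by
  refine iInf₂_le_of_le ((Kernel.id ×ₖ Kernel.const X ρ).map g) (Kernel.IsMarkovKernel.map _ hg)
    (le_of_eq ?_)
  simp_rw [← Measure.map_comp _ _ hg, ← Measure.compProd_eq_comp_prod, Measure.compProd_const]

end Deficiency

/-! ### Increments of fractional Brownian motion on a grid -/

section Increments

variable {H : ℝ} {n : ℕ}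

/-- The point `k / n` of the unit interval. -/
noncomputable def gridPoint (n : ℕ) (k : Fin (n + 1)) : unitInterval :=
  ⟨(k : ℝ) / n, by positivity,
    div_le_one_of_le₀ (by exact_mod_cast Nat.lt_succ_iff.1 k.2) (by positivity)⟩

theorem coe_gridPoint_succ (i : Fin n) : (gridPoint n i.succ : ℝ) = ((i : ℝ) + 1) / n := by
  simp [gridPoint]

theorem coe_gridPoint_castSucc (i : Fin n) : (gridPoint n i.castSucc : ℝ) = (i : ℝ) / n := by
  simp [gridPoint]

/-- The increments `n (y (i / n) - y ((i - 1) / n))`, `i = 1, …, n`, of a function `y`. -/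
noncomputable def scaledIncrements (n : ℕ) : C(unitInterval, ℝ) →ₗ[ℝ] (Fin n → ℝ) where
  toFun y i := n * (y (gridPoint n i.succ) - y (gridPoint n i.castSucc))
  map_add' y z := by ext i; simp; ring
  map_smul' c y := by ext i; simp; ring

theorem scaledIncrements_apply (y : C(unitInterval, ℝ)) (i : Fin n) :
    scaledIncrements n y i = n * (y (gridPoint n i.succ) - y (gridPoint n i.castSucc)) := rfl

theorem measurable_scaledIncrements (n : ℕ) : Measurable (scaledIncrements n) :=
  measurable_pi_iff.2 fun i ↦
    (((isPathSpace_continuousMap.measurable_eval _).sub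
      (isPathSpace_continuousMap.measurable_eval _)).const_mul _ : Measurable
        fun y : C(unitInterval, ℝ) ↦ (n : ℝ) * (y (gridPoint n i.succ) - y (gridPoint n i.castSucc)))

theorem scaledIncrements_antiderivative {f : ℝ → ℝ} (hf : IntervalIntegrable f volume 0 1)
    (i : Fin n) : scaledIncrements n (antiderivative f hf) i =
      n * ∫ u in ((i : ℝ) / n)..(((i : ℝ) + 1) / n), f u := by
  have h : ∀ t : unitInterval, IntervalIntegrable f volume 0 t := fun t ↦ by
    refine hf.mono_set ?_
    rw [Set.uIcc_of_le t.2.1, Set.uIcc_of_le zero_le_one]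
    exact Set.Icc_subset_Icc le_rfl t.2.2
  rw [scaledIncrements_apply, ← coe_gridPoint_succ, ← coe_gridPoint_castSucc,
    ← intervalIntegral.integral_interval_sub_left (h _) (h _)]
  rfl

/-- The covariance matrix of `n` consecutive fractional Gaussian noise variables. -/
noncomputable def fgnMatrix (H : ℝ) (n : ℕ) : Matrix (Fin n) (Fin n) ℝ :=
  Matrix.of fun i j ↦ fgnCov H ((i : ℝ) - j)

theorem fgnMatrix_comm (i j : Fin n) : fgnMatrix H n i j = fgnMatrix H n j i := by
  simp only [fgnMatrix, Matrix.of_apply, fgnCov]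
  rw [show (i : ℝ) - j + 1 = -(j - i - 1) by ring, show (i : ℝ) - j - 1 = -(j - i + 1) by ring,
    show (i : ℝ) - j = -(j - i) by ring]
  simp only [abs_neg]
  ring

/-- The eigenvalue bound forces every vector of the kernel to vanish. -/
theorem isUnit_det_fgnMatrix (hH : H ∈ Set.Ioo (0 : ℝ) 1) (n : ℕ) :
    IsUnit (fgnMatrix H n).det := by
  rw [← Matrix.isUnit_iff_isUnit_det, ← Matrix.mulVec_injective_iff_isUnit]
  rcases n.eq_zero_or_pos with rfl | hn
  · exact Function.injective_of_subsingleton _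
  refine (injective_iff_map_eq_zero (Matrix.mulVecLin (fgnMatrix H n))).2 fun c hc ↦ ?_
  obtain ⟨a, ha, h⟩ := exists_pos_mul_sum_sq_le hH
  have h1 := h n hn c
  have h2 : ∑ i, ∑ j, c i * c j * fgnCov H ((i : ℝ) - j) = 0 := by
    refine Finset.sum_eq_zero fun i _ ↦ ?_
    have := congrFun hc i
    simp only [Matrix.mulVecLin_apply, Matrix.mulVec, dotProduct, Pi.zero_apply] at this
    calc ∑ j, c i * c j * fgnCov H ((i : ℝ) - j)
        = c i * ∑ j, fgnMatrix H n i j * c j := by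
          rw [Finset.mul_sum]
          exact Finset.sum_congr rfl fun j _ ↦ by simp only [fgnMatrix, Matrix.of_apply]; ring
      _ = 0 := by rw [this, mul_zero]
  rw [h2, mul_zero] at h1
  have h3 : ∑ i, c i ^ 2 = 0 :=
    le_antisymm (nonpos_of_mul_nonpos_right h1 ha) (by positivity)
  ext i
  simpa using (Finset.sum_eq_zero_iff_of_nonneg fun i _ ↦ sq_nonneg _).1 h3 i (Finset.mem_univ i)

theorem fbmCov_div_div (s t : ℝ) :
    fbmCov H (s / n) (t / n) = ((n : ℝ) ^ (2 * H))⁻¹ * fbmCov H s t := by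
  have hn' : (0 : ℝ) ≤ n := n.cast_nonneg
  simp only [fbmCov, ← sub_div, abs_div, Nat.abs_cast, Real.div_rpow (abs_nonneg _) hn']
  ring

theorem sq_rpow_mul_cast (hn : 0 < n) : ((n : ℝ) ^ (H - 1) * n) ^ 2 = (n : ℝ) ^ (2 * H) := by
  have hn' : (0 : ℝ) < n := Nat.cast_pos.2 hn
  rw [← Real.rpow_add_one hn'.ne', ← Real.rpow_natCast, ← Real.rpow_mul hn'.le]
  congr 1
  push_cast
  ring

/-- Self-similarity: rescaling time by `n` divides the covariance by `n ^ (2 * H)`, and the noise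
level `n ^ (H - 1)` times the factor `n` of the increments compensates this exactly. -/
theorem fgnMatrix_eq_fbmCov (hn : 0 < n) (i j : Fin n) :
    fgnMatrix H n i j = ((n : ℝ) ^ (H - 1) * n) ^ 2 *
      (fbmCov H (gridPoint n i.succ) (gridPoint n j.succ) -
        fbmCov H (gridPoint n i.succ) (gridPoint n j.castSucc) -
        fbmCov H (gridPoint n i.castSucc) (gridPoint n j.succ) +
        fbmCov H (gridPoint n i.castSucc) (gridPoint n j.castSucc)) := by
  have hn' : (0 : ℝ) < n := Nat.cast_pos.2 hn
  simp only [coe_gridPoint_succ, coe_gridPoint_castSucc, fbmCov_div_div, sq_rpow_mul_cast hn]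
  rw [fgnMatrix, Matrix.of_apply, fgnCov_eq_fbmCov]
  field_simp

end Increments

/-! ### Covariances of the rescaled path and of its increments. -/

namespace IsFractionalBrownianMotion

variable {Ω : Type*} [MeasurableSpace Ω] {P : Measure Ω} {H : ℝ} {B : ℝ≥0 → Ω → ℝ} {n : ℕ}

/-- The path `n ^ (H - 1) B` on `[0, 1]`. -/
noncomputable def scaledPath (hB : IsFractionalBrownianMotion H B P) (n : ℕ) (ω : Ω) :
    C(unitInterval, ℝ) :=
  (n : ℝ) ^ (H - 1) • hB.path ω

variable (hB : IsFractionalBrownianMotion H B P)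
include hB

theorem measurable_scaledPath : Measurable (hB.scaledPath n) :=
  ((continuous_const_smul ((n : ℝ) ^ (H - 1))).measurable.comp hB.measurable_path :)

theorem measurable_scaledPath_apply (t : unitInterval) :
    Measurable fun ω ↦ hB.scaledPath n ω t :=
  isPathSpace_continuousMap.measurable_iff.1 hB.measurable_scaledPath t

theorem isGaussianProcess_scaledPath :
    IsGaussianProcess (fun (t : unitInterval) ω ↦ hB.scaledPath n ω t) P :=
  (hB.isGaussianProcess.comp_right fun t : unitInterval ↦ (⟨t, t.2.1⟩ : ℝ≥0)).smul
    fun _ ↦ (n : ℝ) ^ (H - 1)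

theorem memLp_scaledPath (t : unitInterval) : MemLp (fun ω ↦ hB.scaledPath n ω t) 2 P :=
  (hB.isGaussianProcess_scaledPath.hasGaussianLaw_eval t).memLp_two

theorem integral_scaledPath (t : unitInterval) : ∫ ω, hB.scaledPath n ω t ∂P = 0 := by
  have : ∀ ω, hB.scaledPath n ω t = (n : ℝ) ^ (H - 1) * B ⟨t, t.2.1⟩ ω := fun ω ↦ rfl
  simp_rw [this, integral_const_mul]
  exact mul_eq_zero_of_right _ (hB.mean_eq_zero _)

theorem covariance_scaledPath (s t : unitInterval) :
    cov[fun ω ↦ hB.scaledPath n ω s, fun ω ↦ hB.scaledPath n ω t; P] =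
      ((n : ℝ) ^ (H - 1)) ^ 2 * fbmCov H s t := by
  have : ∀ (t : unitInterval) ω, hB.scaledPath n ω t = (n : ℝ) ^ (H - 1) * B ⟨t, t.2.1⟩ ω :=
    fun t ω ↦ rfl
  simp_rw [this]
  have h := hB.covariance_eq ⟨s, s.2.1⟩ ⟨t, t.2.1⟩
  rw [covariance_const_mul_left, covariance_const_mul_right, h, sq, mul_assoc]
  rfl

/-- The increments of the path `n ^ (H - 1) B`, multiplied by `n`. -/
noncomputable def noise (n : ℕ) (i : Fin n) (ω : Ω) : ℝ :=
  scaledIncrements n (hB.scaledPath n ω) i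

theorem measurable_noise (i : Fin n) : Measurable (hB.noise n i) :=
  (measurable_pi_apply i).comp ((measurable_scaledIncrements n).comp hB.measurable_scaledPath)

theorem noise_eq (i : Fin n) : hB.noise n i = fun ω ↦ (n : ℝ) *
    (hB.scaledPath n ω (gridPoint n i.succ) - hB.scaledPath n ω (gridPoint n i.castSucc)) := rfl

theorem noise_mem_span (i : Fin n) : hB.noise n i ∈
    Submodule.span ℝ (Set.range fun (t : unitInterval) ω ↦ hB.scaledPath n ω t) :=
  Submodule.smul_mem _ (n : ℝ) (sub_mem (Submodule.subset_span ⟨gridPoint n i.succ, rfl⟩)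
    (Submodule.subset_span ⟨gridPoint n i.castSucc, rfl⟩))

theorem isGaussianProcess_noise : IsGaussianProcess (hB.noise n) P :=
  isGaussianProcess_of_mem_span hB.isGaussianProcess_scaledPath hB.noise_mem_span

theorem integral_noise (i : Fin n) : P[hB.noise n i] = 0 := by
  have := hB.isGaussianProcess.isProbabilityMeasure
  simp_rw [noise_eq]
  rw [integral_const_mul, integral_sub ((hB.memLp_scaledPath _).integrable one_le_two)
    ((hB.memLp_scaledPath _).integrable one_le_two), integral_scaledPath, integral_scaledPath]
  simp

theorem covariance_scaledPath_noise (t : unitInterval) (i : Fin n) :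
    cov[fun ω ↦ hB.scaledPath n ω t, hB.noise n i; P] = ((n : ℝ) ^ (H - 1)) ^ 2 * (n *
      (fbmCov H t (gridPoint n i.succ) - fbmCov H t (gridPoint n i.castSucc))) := by
  have := hB.isGaussianProcess.isProbabilityMeasure
  rw [noise_eq, covariance_const_mul_right, covariance_fun_sub_right (hB.memLp_scaledPath _)
    (hB.memLp_scaledPath _) (hB.memLp_scaledPath _), covariance_scaledPath, covariance_scaledPath]
  ring

theorem covariance_noise (hn : 0 < n) (i j : Fin n) :
    cov[hB.noise n i, hB.noise n j; P] = fgnMatrix H n i j := by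
  have := hB.isGaussianProcess.isProbabilityMeasure
  conv_lhs => rw [hB.noise_eq i]
  rw [covariance_const_mul_left, covariance_fun_sub_left (hB.memLp_scaledPath _)
    (hB.memLp_scaledPath _) (hB.isGaussianProcess_noise.hasGaussianLaw_eval j).memLp_two,
    covariance_scaledPath_noise, covariance_scaledPath_noise, fgnMatrix_eq_fbmCov hn]
  ring

end IsFractionalBrownianMotion

/-! ### Replacing point evaluations by local averages in the regression experiment -/

section Regression

variable {Ω Ω' : Type*} [MeasurableSpace Ω] [MeasurableSpace Ω'] {P : Measure Ω}
  {P' : Measure Ω'} {H : ℝ} {N : ℕ → Ω → ℝ} {B : ℝ≥0 → Ω' → ℝ} {n : ℕ}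

/-- Stationarity makes the shift of index by one harmless, since the covariance depends only on `i -
j`. -/
theorem IsFractionalGaussianNoise.map_eq_map_noise (hN : IsFractionalGaussianNoise H N P)
    (hB : IsFractionalBrownianMotion H B P') (hn : 0 < n) :
    P.map (fun ω (i : Fin n) ↦ N ((i : ℕ) + 1) ω) = P'.map fun ω i ↦ hB.noise n i ω := by
  have h1 : IsGaussianProcess (fun (i : Fin n) ↦ N ((i : ℕ) + 1)) P :=
    hN.isGaussianProcess.comp_right fun i : Fin n ↦ (i : ℕ) + 1
  refine map_eq_of_covariance_eq (hasGaussianLaw_pi_of_isGaussianProcess h1)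
    (hasGaussianLaw_pi_of_isGaussianProcess hB.isGaussianProcess_noise)
    (fun i ↦ hN.mean_eq_zero _) hB.integral_noise fun i j ↦ ?_
  rw [hN.covariance_eq, hB.covariance_noise hn, fgnMatrix, Matrix.of_apply, fgnCov]
  push_cast
  simp only [add_sub_add_right_eq_sub]

/-- The squared Cameron-Martin norm of a vector under fractional Gaussian noise is controlled by its
squared Euclidean norm. -/
theorem exists_dotProduct_fgnMatrix_mulVec_le (hH : H ∈ Set.Ioo (0 : ℝ) 1) :
    ∃ C : ℝ, 0 < C ∧ ∀ n : ℕ, 0 < n → ∀ d : Fin n → ℝ, ∃ c : Fin n → ℝ,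
      (∀ i, ∑ j, c j * fgnMatrix H n i j = d i) ∧
        ∑ i, ∑ j, c i * c j * fgnMatrix H n i j ≤
          C * (max ((n : ℝ) ^ (1 - 2 * H)) 1 * ∑ i, d i ^ 2) := by
  obtain ⟨a, ha, h⟩ := exists_pos_mul_sum_sq_le hH
  refine ⟨a⁻¹, inv_pos.2 ha, fun n hn d ↦ ⟨(fgnMatrix H n)⁻¹.mulVec d, ?_, ?_⟩⟩
  all_goals set c := (fgnMatrix H n)⁻¹.mulVec d with hc
  all_goals
    have hcd : ∀ i, ∑ j, c j * fgnMatrix H n i j = d i := fun i ↦ by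
      have : (fgnMatrix H n).mulVec c = d := by
        rw [hc, Matrix.mulVec_mulVec, Matrix.mul_nonsing_inv _ (isUnit_det_fgnMatrix hH n),
          Matrix.one_mulVec]
      rw [← this]
      simp [Matrix.mulVec, dotProduct, mul_comm]
  · exact hcd
  · have h1 := h n hn c
    set M := max ((n : ℝ) ^ (1 - 2 * H)) 1
    have hM : 0 < M := lt_max_of_lt_right one_pos
    set v := ∑ i, ∑ j, c i * c j * fgnMatrix H n i j with hv
    have hvd : v = ∑ i, c i * d i := by
      refine Finset.sum_congr rfl fun i _ ↦ ?_
      rw [← hcd, Finset.mul_sum]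
      exact Finset.sum_congr rfl fun j _ ↦ by ring
    -- With `v = cᵀ Γ c = cᵀ d`, Cauchy–Schwarz and the eigenvalue bound `a ∑ c i ^ 2 ≤ M v` combine
    -- to `a v² ≤ M v ∑ d i ^ 2`; it remains to divide by `v`.
    have h2 : v ^ 2 ≤ (∑ i, c i ^ 2) * ∑ i, d i ^ 2 := by
      rw [hvd]
      exact Finset.sum_mul_sq_le_sq_mul_sq _ _ _
    have h3 : a * ∑ i, c i ^ 2 ≤ M * v := h1
    have h4 : 0 ≤ ∑ i, d i ^ 2 := by positivity
    rcases le_or_gt v 0 with h0 | h0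
    · exact h0.trans (by positivity)
    · rw [← div_eq_inv_mul, le_div_iff₀ ha]
      refine le_of_mul_le_mul_left ?_ h0
      calc v * (v * a) = a * v ^ 2 := by ring
        _ ≤ a * ((∑ i, c i ^ 2) * ∑ i, d i ^ 2) := by gcongr
        _ = (a * ∑ i, c i ^ 2) * ∑ i, d i ^ 2 := by ring
        _ ≤ (M * v) * ∑ i, d i ^ 2 := by gcongr
        _ = v * (M * ∑ i, d i ^ 2) := by ring

/-- Both laws are translates of the same noise law, by point values and by local averages of `f`.
Their difference `d = Γ c` is the covariance function of `U = ∑ c i * noise i`, whose variance is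
`dᵀ Γ⁻¹ d`. -/
theorem exists_tvDist_regressionLaw_le (hH : H ∈ Set.Ioo (0 : ℝ) 1)
    (hN : IsFractionalGaussianNoise H N P) (hB : IsFractionalBrownianMotion H B P') :
    ∃ C : ℝ, 0 < C ∧ ∀ n : ℕ, 0 < n → ∀ (f : ℝ → ℝ) (hf : IntervalIntegrable f volume 0 1),
      tvDist (regressionLaw N P n f)
        ((continuousLaw hB n f hf).map (scaledIncrements n)) ≤
      ENNReal.ofReal (2 * √(C * (max ((n : ℝ) ^ (1 - 2 * H)) 1 * ∑ i : Fin n,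
        (n * (∫ u in ((i : ℝ) / n)..(((i : ℝ) + 1) / n), f u) - f (((i : ℝ) + 1) / n)) ^ 2))) := by
  have := hN.isGaussianProcess.isProbabilityMeasure
  have := hB.isGaussianProcess.isProbabilityMeasure
  obtain ⟨C, hC, h⟩ := exists_dotProduct_fgnMatrix_mulVec_le hH
  refine ⟨C, hC, fun n hn f hf ↦ ?_⟩
  set b : Fin n → ℝ := fun i ↦ f (((i : ℝ) + 1) / n) with hb
  set d : Fin n → ℝ := fun i ↦ n * (∫ u in ((i : ℝ) / n)..(((i : ℝ) + 1) / n), f u) - b i with hd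
  obtain ⟨c, hcd, hcv⟩ := h n hn d
  have hML : ∀ i, MemLp (hB.noise n i) 2 P' := fun i ↦
    (hB.isGaussianProcess_noise.hasGaussianLaw_eval i).memLp_two
  have hMm : ∀ i, Measurable (hB.noise n i) := fun i ↦ hB.measurable_noise i
  have hMv : Measurable fun ω (i : Fin n) ↦ hB.noise n i ω := measurable_pi_iff.2 hMm
  have hNv : Measurable fun ω (i : Fin n) ↦ N ((i : ℕ) + 1) ω :=
    measurable_pi_iff.2 fun i ↦ hN.measurable _
  have hg : Measurable fun x : Fin n → ℝ ↦ b + x := measurable_id.const_add b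
  set U : Ω' → ℝ := fun ω ↦ ∑ i, c i * hB.noise n i ω with hU
  have hcov : ∀ i, cov[hB.noise n i, U; P'] = d i := fun i ↦ by
    rw [hU, covariance_fun_sum_right (fun i ↦ (hML i).const_mul _) (hML i)]
    simp_rw [covariance_const_mul_right, hB.covariance_noise hn, hcd]
  have hvar : Var[U; P'] = ∑ i, ∑ j, c i * c j * fgnMatrix H n i j := by
    rw [hU, variance_fun_sum fun i ↦ (hML i).const_mul _]
    simp_rw [covariance_const_mul_left, covariance_const_mul_right, hB.covariance_noise hn,
      mul_assoc]
  have key := (IsPathSpace.pi (Fin n)).tvDist_map_add_le (P := P') (U := U) (X := hB.noise n)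
    (isGaussianProcess_of_mem_span (hB.isGaussianProcess_noise (n := n)) ?_) (by fun_prop) ?_ hMm
    (path := fun ω i ↦ hB.noise n i ω) (fun _ _ ↦ rfl) (h := d) (fun i ↦ (hcov i).symm)
  · have e1 : regressionLaw N P n f = (P'.map fun ω i ↦ hB.noise n i ω).map (b + ·) := by
      rw [← hN.map_eq_map_noise hB hn, Measure.map_map hg hNv]
      rfl
    have e2 : (continuousLaw hB n f hf).map (scaledIncrements n) =
        (P'.map fun ω ↦ (fun i ↦ hB.noise n i ω) + d).map (b + ·) := by
      have hcl : Measurable fun ω ↦ antiderivative f hf + ((n : ℝ) ^ (H - 1)) • hB.path ω :=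
        ((continuous_const.add continuous_id).measurable.comp (hB.measurable_scaledPath (n := n)) :
          Measurable ((fun x ↦ antiderivative f hf + x) ∘ hB.scaledPath n))
      rw [continuousLaw, Measure.map_map (measurable_scaledIncrements n) hcl,
        Measure.map_map hg (hMv.add_const d)]
      congr 1
      ext ω i
      simp only [Function.comp_apply, map_add, Pi.add_apply, scaledIncrements_antiderivative, hd]
      have : hB.noise n i ω = scaledIncrements n ((n : ℝ) ^ (H - 1) • hB.path ω) i := rfl
      rw [this]
      ring
    have := Measure.isProbabilityMeasure_map (μ := P') hMv.aemeasurable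
    have := Measure.isProbabilityMeasure_map (μ := P') (hMv.add_const d).aemeasurable
    rw [e1, e2]
    refine (tvDist_map_le _ _ hg).trans (key.trans (ENNReal.ofReal_le_ofReal ?_))
    rw [hvar]
    gcongr
  · rintro (_ | i)
    · have : U = ∑ i, c i • hB.noise n i := by ext ω; simp [hU]
      simp only [Sum.elim_inl, this]
      exact sum_mem fun i _ ↦ Submodule.smul_mem _ _ (Submodule.subset_span ⟨i, rfl⟩)
    · exact Submodule.subset_span ⟨i, rfl⟩
  · rw [hU, integral_finsetSum _ fun i _ ↦ ((hML i).integrable one_le_two).const_mul _]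
    refine Finset.sum_eq_zero fun i _ ↦ ?_
    rw [integral_const_mul, hB.integral_noise, mul_zero]

end Regression

/-! ### Interpolation in the reproducing kernel Hilbert space -/

section Interpolation

variable {H : ℝ} {n : ℕ}

/-- The covariance function `t ↦ n ^ (2 * H - 2) cov (B t, n (B (i / n) - B ((i - 1) / n)))`. -/
noncomputable def incrementCov (hH : H ∈ Set.Ioo (0 : ℝ) 1) (n : ℕ) (i : Fin n) :
    C(unitInterval, ℝ) where
  toFun t := ((n : ℝ) ^ (H - 1)) ^ 2 * (n *
    (fbmCov H t (gridPoint n i.succ) - fbmCov H t (gridPoint n i.castSucc)))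
  continuous_toFun := continuous_const.mul (continuous_const.mul
    (((continuous_fbmCov hH _).comp continuous_subtype_val).sub
      ((continuous_fbmCov hH _).comp continuous_subtype_val)))

/-- The minimum norm interpolation of a path with prescribed increments. -/
noncomputable def interpolate (hH : H ∈ Set.Ioo (0 : ℝ) 1) (n : ℕ) (y : Fin n → ℝ) :
    C(unitInterval, ℝ) :=
  ∑ j, (∑ k, (fgnMatrix H n)⁻¹ j k * y k) • incrementCov hH n j

theorem interpolate_add (hH : H ∈ Set.Ioo (0 : ℝ) 1) (y z : Fin n → ℝ) :
    interpolate hH n (y + z) = interpolate hH n y + interpolate hH n z := by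
  simp [interpolate, mul_add, Finset.sum_add_distrib, add_smul]

theorem measurable_interpolate (hH : H ∈ Set.Ioo (0 : ℝ) 1) (n : ℕ) :
    Measurable (interpolate hH n) := by
  have : Continuous fun y : Fin n → ℝ ↦
      ∑ j, (∑ k, (fgnMatrix H n)⁻¹ j k * y k) • incrementCov hH n j := by
    fun_prop
  exact this.measurable

theorem sum_inv_fgnMatrix_mul (hH : H ∈ Set.Ioo (0 : ℝ) 1) (i j : Fin n) :
    ∑ k, (fgnMatrix H n)⁻¹ j k * fgnMatrix H n i k = if i = j then 1 else 0 := by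
  have := congrFun (congrFun (Matrix.nonsing_inv_mul _ (isUnit_det_fgnMatrix hH n)) j) i
  rw [Matrix.mul_apply, Matrix.one_apply] at this
  simp_rw [fgnMatrix_comm i]
  rw [this]
  simp [eq_comm]

theorem sum_fgnMatrix_mul_sum_inv (hH : H ∈ Set.Ioo (0 : ℝ) 1) (y : Fin n → ℝ) (i : Fin n) :
    ∑ j, (∑ k, (fgnMatrix H n)⁻¹ j k * y k) * fgnMatrix H n i j = y i := by
  have h : (fgnMatrix H n).mulVec ((fgnMatrix H n)⁻¹.mulVec y) = y := by
    rw [Matrix.mulVec_mulVec, Matrix.mul_nonsing_inv _ (isUnit_det_fgnMatrix hH n),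
      Matrix.one_mulVec]
  have := congrFun h i
  simp only [Matrix.mulVec, dotProduct] at this
  simpa [mul_comm] using this

variable [Fact (fbmKernel H).PosSemidef]

/-- The process starts at zero, so increments and values on the grid determine each other. -/
theorem fbmKer_gridPoint_zero (hH : H ∈ Set.Ioo (0 : ℝ) 1) : fbmKer H (gridPoint n 0) = 0 := by
  rw [← inner_self_eq_zero (𝕜 := ℝ), inner_fbmKer, fbmKer_apply]
  have : 2 * H ≠ 0 := by linarith [hH.1]
  simp [gridPoint, fbmCov, Real.zero_rpow this]

/-- Among all functions that differ from `F` by a combination of kernel functions at grid points,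
the interpolation error of `F` has the smallest norm. -/
theorem exists_coe_eq_sub_interpolate (hH : H ∈ Set.Ioo (0 : ℝ) 1) (hn : 0 < n)
    {F : C(unitInterval, ℝ)} {α : Fin n → ℝ} {φ : RKHS.OfKernel (fbmKernel H)}
    (hφ : ∀ t, φ t = F t - ∑ j, α j * fbmCov H t (gridPoint n j.succ)) :
    ∃ χ : RKHS.OfKernel (fbmKernel H), ⇑χ = F - interpolate hH n (scaledIncrements n F) ∧
      ‖χ‖ ≤ ‖φ‖ := by
  set E : Fin n → RKHS.OfKernel (fbmKernel H) := fun i ↦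
    (n : ℝ) • (fbmKer H (gridPoint n i.succ) - fbmKer H (gridPoint n i.castSucc)) with hE
  set a : ℝ := ((n : ℝ) ^ (H - 1)) ^ 2 with ha
  set y := scaledIncrements n F with hy
  set β : Fin n → ℝ := fun j ↦ ∑ k, (fgnMatrix H n)⁻¹ j k * y k with hβ
  set κ : RKHS.OfKernel (fbmKernel H) := ∑ j, α j • fbmKer H (gridPoint n j.succ) with hκ
  set π : RKHS.OfKernel (fbmKernel H) := ∑ j, β j • (a • E j) with hπ
  have hn' : (n : ℝ) ≠ 0 := Nat.cast_ne_zero.2 hn.ne'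
  have hEψ : ∀ i (ψ : RKHS.OfKernel (fbmKernel H)), inner ℝ (E i) ψ =
      n * (ψ (gridPoint n i.succ) - ψ (gridPoint n i.castSucc)) := fun i ψ ↦ by
    simp only [hE, real_inner_smul_left, inner_sub_left, inner_fbmKer]
  have hEt : ∀ i t, (E i) t =
      n * (fbmCov H t (gridPoint n i.succ) - fbmCov H t (gridPoint n i.castSucc)) := fun i t ↦ by
    simp only [hE, RKHS.coe_smul, RKHS.coe_sub, Pi.smul_apply, Pi.sub_apply, fbmKer_apply,
      smul_eq_mul]
  have hEE : ∀ i j, a * inner ℝ (E i) (E j) = fgnMatrix H n i j := fun i j ↦ by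
    rw [hEψ, hEt, hEt, fgnMatrix_eq_fbmCov hn]
    ring
  have hκt : ∀ t, κ t = ∑ j, α j * fbmCov H t (gridPoint n j.succ) := fun t ↦ by
    rw [← inner_fbmKer, hκ, inner_sum]
    simp_rw [inner_smul_right, inner_fbmKer, fbmKer_apply]
  have hπt : ∀ t, π t = interpolate hH n y t := fun t ↦ by
    rw [← inner_fbmKer, hπ, inner_sum, interpolate, ContinuousMap.coe_sum, Finset.sum_apply]
    simp_rw [inner_smul_right, inner_fbmKer, hEt]
    rfl
  set χ := φ + κ - π with hχ
  -- Here `φ + κ` represents `F` in the Hilbert space and `π` is its projection on the span of the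
  -- `E i`.
  have hχt : ∀ t, χ t = F t - interpolate hH n y t := fun t ↦ by
    simp only [hχ, RKHS.coe_sub, RKHS.coe_add, Pi.sub_apply, Pi.add_apply, hφ, hκt, hπt]
    ring
  have hEχ : ∀ i, inner ℝ (E i) χ = 0 := fun i ↦ by
    have h1 : inner ℝ (E i) (φ + κ) = y i := by
      rw [hEψ, hy, scaledIncrements_apply]
      simp only [RKHS.coe_add, Pi.add_apply, hφ, hκt, sub_add_cancel]
    have h2 : inner ℝ (E i) π = y i := by
      rw [hπ, inner_sum, ← sum_fgnMatrix_mul_sum_inv hH y i]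
      simp_rw [inner_smul_right, hEE, hβ]
    rw [hχ, inner_sub_right, h1, h2, sub_self]
  -- Vanishing increments and a vanishing value at `0` telescope to vanishing at every grid point.
  have hgrid : ∀ k : Fin (n + 1), inner ℝ (fbmKer H (gridPoint n k)) χ = 0 := fun k ↦ by
    induction k using Fin.induction with
    | zero => rw [fbmKer_gridPoint_zero hH, inner_zero_left]
    | succ i ih =>
      have := hEχ i
      simp only [hE, real_inner_smul_left, inner_sub_left, ih, sub_zero] at this
      exact (mul_eq_zero.1 this).resolve_left hn'
  have horth : inner ℝ χ (π - κ) = 0 := by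
    rw [real_inner_comm, inner_sub_left, hπ, hκ, sum_inner, sum_inner]
    simp_rw [real_inner_smul_left, hEχ, hgrid]
    simp
  refine ⟨χ, funext hχt, ?_⟩
  -- Pythagoras: the second summand lies in the span of the grid kernels, to which `χ` is
  -- orthogonal.
  have hsum : φ = χ + (π - κ) := by rw [hχ]; abel
  have hnorm := norm_add_sq_eq_norm_sq_add_norm_sq_of_inner_eq_zero _ _ horth
  rw [← hsum] at hnorm
  nlinarith [norm_nonneg χ, norm_nonneg φ, norm_nonneg (π - κ)]

end Interpolation

/-! ### Asymptotic equivalence -/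

section AsymptoticEquivalence

variable {Ω Ω' : Type*} [MeasurableSpace Ω] [MeasurableSpace Ω'] {P : Measure Ω}
  {P' : Measure Ω'} {H : ℝ} {N : ℕ → Ω → ℝ} {B : ℝ≥0 → Ω' → ℝ} {n : ℕ}

namespace IsFractionalBrownianMotion

/-- The deviation of the path `n ^ (H - 1) B` from the interpolation of its increments. -/
noncomputable def residual (hH : H ∈ Set.Ioo (0 : ℝ) 1) (hB : IsFractionalBrownianMotion H B P')
    (n : ℕ) (ω : Ω') : C(unitInterval, ℝ) :=
  hB.scaledPath n ω - interpolate hH n fun i ↦ hB.noise n i ω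

theorem measurable_residual (hH : H ∈ Set.Ioo (0 : ℝ) 1) (hB : IsFractionalBrownianMotion H B P') :
    Measurable (hB.residual hH n) :=
  hB.measurable_scaledPath.sub
    ((measurable_interpolate hH n).comp (measurable_pi_iff.2 hB.measurable_noise))

theorem indepFun_noise_residual (hH : H ∈ Set.Ioo (0 : ℝ) 1)
    (hB : IsFractionalBrownianMotion H B P') (hn : 0 < n) :
    IndepFun (fun ω i ↦ hB.noise n i ω) (hB.residual hH n) P' := by
  refine isPathSpace_continuousMap.indepFun_residual (U := hB.noise n)
    (X := fun (t : unitInterval) ω ↦ hB.scaledPath n ω t) (A := (fgnMatrix H n)⁻¹)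
    (isGaussianProcess_of_mem_span (hB.isGaussianProcess_scaledPath (n := n)) ?_)
    hB.measurable_noise hB.measurable_scaledPath_apply (fun _ _ ↦ rfl) (fun i j ↦ ?_)
    fun j t ↦ (hB.covariance_scaledPath_noise t j).symm
  · rintro (i | t)
    · exact hB.noise_mem_span i
    · exact Submodule.subset_span ⟨t, rfl⟩
  · simp_rw [hB.covariance_noise hn]
    exact sum_inv_fgnMatrix_mul hH i j

theorem continuousLaw_eq_map_scaledPath (hB : IsFractionalBrownianMotion H B P') {f : ℝ → ℝ}
    (hf : IntervalIntegrable f volume 0 1) :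
    continuousLaw hB n f hf = P'.map fun ω ↦ antiderivative f hf + hB.scaledPath n ω := rfl

theorem measurable_add_scaledPath (hB : IsFractionalBrownianMotion H B P')
    (F : C(unitInterval, ℝ)) : Measurable fun ω ↦ F + hB.scaledPath n ω :=
  ((continuous_const.add continuous_id).measurable.comp hB.measurable_scaledPath :
    Measurable ((fun x ↦ F + x) ∘ hB.scaledPath n))

instance isProbabilityMeasure_continuousLaw (hB : IsFractionalBrownianMotion H B P') (n : ℕ)
    {f : ℝ → ℝ} (hf : IntervalIntegrable f volume 0 1) :
    IsProbabilityMeasure (continuousLaw hB n f hf) :=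
  haveI := hB.isGaussianProcess.isProbabilityMeasure
  Measure.isProbabilityMeasure_map (hB.measurable_add_scaledPath _).aemeasurable

/-- Adding an independent residual to the interpolated increments restores the path, up to the
interpolation error of the drift. -/
theorem map_interpolate_add_residual (hH : H ∈ Set.Ioo (0 : ℝ) 1)
    (hB : IsFractionalBrownianMotion H B P') (hn : 0 < n) {f : ℝ → ℝ}
    (hf : IntervalIntegrable f volume 0 1) :
    (((continuousLaw hB n f hf).map (scaledIncrements n)).prod
        (P'.map (hB.residual hH n))).map (fun p ↦ interpolate hH n p.1 + p.2) =
      P'.map fun ω ↦ interpolate hH n (scaledIncrements n (antiderivative f hf)) +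
        hB.scaledPath n ω := by
  have := hB.isGaussianProcess.isProbabilityMeasure
  set y := scaledIncrements n (antiderivative f hf)
  have hMv : Measurable fun ω (i : Fin n) ↦ hB.noise n i ω :=
    measurable_pi_iff.2 hB.measurable_noise
  have hV : Measurable fun ω ↦ y + fun i ↦ hB.noise n i ω := hMv.const_add y
  have hR := hB.measurable_residual (n := n) hH
  have e1 : (continuousLaw hB n f hf).map (scaledIncrements n) =
      P'.map fun ω ↦ y + fun i ↦ hB.noise n i ω := by
    rw [continuousLaw_eq_map_scaledPath, Measure.map_map (measurable_scaledIncrements n)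
      (hB.measurable_add_scaledPath _)]
    congr 1
    ext ω : 1
    simp only [Function.comp_apply, map_add]
    rfl
  have hi : IndepFun (fun ω ↦ y + fun i ↦ hB.noise n i ω) (hB.residual hH n) P' :=
    (hB.indepFun_noise_residual hH hn).comp (measurable_id.const_add y) measurable_id
  have hg : Measurable fun p : (Fin n → ℝ) × C(unitInterval, ℝ) ↦ interpolate hH n p.1 + p.2 :=
    ((measurable_interpolate hH n).comp measurable_fst).add measurable_snd
  rw [e1, ← (indepFun_iff_map_prod_eq_prod_map_map hV.aemeasurable hR.aemeasurable).1 hi,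
    Measure.map_map hg (hV.prodMk hR)]
  congr 1
  ext ω : 1
  simp only [Function.comp_apply, interpolate_add, residual]
  abel

/-- The noise is the same on both sides, so this is the Cameron–Martin estimate for the
interpolation error of the drift; `n ^ (1 - H)` is the inverse of the noise level. -/
theorem tvDist_map_interpolate_le (hH : H ∈ Set.Ioo (0 : ℝ) 1)
    (hB : IsFractionalBrownianMotion H B P') (hn : 0 < n) {f : ℝ → ℝ}
    (hf : IntervalIntegrable f volume 0 1) :
    tvDist (P'.map fun ω ↦ interpolate hH n (scaledIncrements n (antiderivative f hf)) +
        hB.scaledPath n ω) (continuousLaw hB n f hf) ≤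
      2 * ENNReal.ofReal ((n : ℝ) ^ (1 - H)) * ⨅ α : Fin n → ℝ, fbmRKHSENorm hH
        fun t : unitInterval ↦
          (∫ u in (0 : ℝ)..t, f u) - ∑ j : Fin n, α j * fbmCov H t (((j : ℝ) + 1) / n) := by
  have : Fact (fbmKernel H).PosSemidef := ⟨fbmKernel_posSemidef hH⟩
  have hn' : (0 : ℝ) < n := Nat.cast_pos.2 hn
  have hpos : 0 < (n : ℝ) ^ (1 - H) := Real.rpow_pos_of_pos hn' _
  have hc0 : 2 * ENNReal.ofReal ((n : ℝ) ^ (1 - H)) ≠ 0 := by simpa using hpos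
  have hct : 2 * ENNReal.ofReal ((n : ℝ) ^ (1 - H)) ≠ ∞ :=
    ENNReal.mul_ne_top (by simp) ENNReal.ofReal_ne_top
  -- Once the constant is moved to the left, the infimum can be tested on each `α` and each
  -- representative `φ`; an `α` without a representative contributes `∞` and imposes nothing.
  rw [mul_comm (2 * _), ← ENNReal.div_le_iff_le_mul (.inl hc0) (.inl hct)]
  refine le_iInf fun α ↦ le_iInf₂ fun φ hφ ↦ ?_
  obtain ⟨χ, hχ, hle⟩ := exists_coe_eq_sub_interpolate hH hn (F := antiderivative f hf) (α := α)
    (φ := φ) fun t ↦ by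
      rw [hφ]
      simp_rw [coe_gridPoint_succ]
      rfl
  have key := hB.tvDist_map_add_smul_path_le hH hχ (Real.rpow_pos_of_pos hn' (H - 1))
  refine ENNReal.div_le_of_le_mul (key.trans ?_)
  rw [← Real.rpow_neg hn'.le, neg_sub, ← ofReal_norm, mul_comm (ENNReal.ofReal ‖φ‖),
    mul_assoc 2, ← ENNReal.ofReal_mul hpos.le, ENNReal.ofReal_mul zero_le_two,
    ENNReal.ofReal_ofNat]
  gcongr

end IsFractionalBrownianMotion

theorem IsFractionalGaussianNoise.isProbabilityMeasure_regressionLaw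
    (hN : IsFractionalGaussianNoise H N P) (n : ℕ) (f : ℝ → ℝ) :
    IsProbabilityMeasure (regressionLaw N P n f) :=
  haveI := hN.isGaussianProcess.isProbabilityMeasure
  Measure.isProbabilityMeasure_map (Measurable.aemeasurable
    (measurable_pi_iff.2 fun _ ↦ (hN.measurable _).const_add _))

/-- From path to regression the randomization takes increments and pays only the first term. From
regression to path it interpolates and adds an independent copy of the residual, which pays both. -/
theorem leCamDist_le (hH : H ∈ Set.Ioo (0 : ℝ) 1) (hN : IsFractionalGaussianNoise H N P)
    (hB : IsFractionalBrownianMotion H B P') (hn : 0 < n) (Θ : Set (ℝ → ℝ))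
    (hΘ : ∀ f ∈ Θ, IntervalIntegrable f volume 0 1) :
    leCamDist (fun f : Θ ↦ regressionLaw N P n f)
        (fun f : Θ ↦ continuousLaw hB n f (hΘ f f.2)) ≤
      (⨆ f : Θ, tvDist (regressionLaw N P n f)
        ((continuousLaw hB n f (hΘ f f.2)).map (scaledIncrements n))) +
      2 * ENNReal.ofReal ((n : ℝ) ^ (1 - H)) * ⨆ f ∈ Θ, ⨅ α : Fin n → ℝ, fbmRKHSENorm hH
        fun t : unitInterval ↦
          (∫ u in (0 : ℝ)..t, f u) - ∑ j : Fin n, α j * fbmCov H t (((j : ℝ) + 1) / n) := by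
  have := hB.isGaussianProcess.isProbabilityMeasure
  have hP := hN.isProbabilityMeasure_regressionLaw n
  have hR := hB.measurable_residual (n := n) hH
  have hT := measurable_scaledIncrements n
  have := Measure.isProbabilityMeasure_map (μ := P') hR.aemeasurable
  have hmid := fun f : Θ ↦ Measure.isProbabilityMeasure_map
    (μ := continuousLaw hB n f (hΘ f f.2)) hT.aemeasurable
  have hg : Measurable fun p : (Fin n → ℝ) × C(unitInterval, ℝ) ↦ interpolate hH n p.1 + p.2 :=
    ((measurable_interpolate hH n).comp measurable_fst).add measurable_snd
  refine max_le ?_ ?_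
  · refine (deficiency_le_iSup_tvDist_prod_map _ _ (P'.map (hB.residual hH n)) hg).trans
      (iSup_le fun f ↦ ?_)
    have h1 := Measure.isProbabilityMeasure_map (f := fun p ↦ interpolate hH n p.1 + p.2)
      (μ := (regressionLaw N P n f).prod (P'.map (hB.residual hH n))) hg.aemeasurable
    have h2 := Measure.isProbabilityMeasure_map (f := fun p ↦ interpolate hH n p.1 + p.2)
      (μ := ((continuousLaw hB n f (hΘ f f.2)).map (scaledIncrements n)).prod
        (P'.map (hB.residual hH n))) hg.aemeasurable
    refine (tvDist_triangle _ _ _).trans (add_le_add (((tvDist_map_le _ _ hg).trans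
      (tvDist_prod_le _ _ _)).trans (le_iSup (fun f : Θ ↦ tvDist (regressionLaw N P n f)
        ((continuousLaw hB n f (hΘ f f.2)).map (scaledIncrements n))) f)) ?_)
    rw [hB.map_interpolate_add_residual hH hn]
    refine (hB.tvDist_map_interpolate_le hH hn _).trans ?_
    gcongr
    exact le_iSup₂ (f := fun (f : ℝ → ℝ) (_ : f ∈ Θ) ↦ ⨅ α : Fin n → ℝ, fbmRKHSENorm hH
        fun t : unitInterval ↦
          (∫ u in (0 : ℝ)..t, f u) - ∑ j : Fin n, α j * fbmCov H t (((j : ℝ) + 1) / n)) f.1 f.2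
  · refine (deficiency_le_iSup_tvDist_map _ _ hT).trans (le_trans ?_ le_self_add)
    simp_rw [tvDist_comm (Measure.map _ _)]
    exact le_rfl

theorem exists_iSup_tvDist_le (hH : H ∈ Set.Ioo (0 : ℝ) 1) (hN : IsFractionalGaussianNoise H N P)
    (hB : IsFractionalBrownianMotion H B P') (Θ : Set (ℝ → ℝ))
    (hΘ : ∀ f ∈ Θ, IntervalIntegrable f volume 0 1) :
    ∃ C : ℝ≥0∞, C ≠ ∞ ∧ ∀ n : ℕ, 0 < n →
      (⨆ f : Θ, tvDist (regressionLaw N P n f)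
        ((continuousLaw hB n f (hΘ f f.2)).map (scaledIncrements n))) ≤
      2 * (C * (ENNReal.ofReal (max ((n : ℝ) ^ (1 - 2 * H)) 1) *
        ⨆ f ∈ Θ, ENNReal.ofReal (∑ i ∈ Finset.Icc 1 n,
          ((n : ℝ) * (∫ u in (((i : ℝ) - 1) / n)..((i : ℝ) / n), f u) - f ((i : ℝ) / n)) ^ 2)))
        ^ (1 / 2 : ℝ) := by
  obtain ⟨C, hC, h⟩ := exists_tvDist_regressionLaw_le hH hN hB
  refine ⟨ENNReal.ofReal C, ENNReal.ofReal_ne_top, fun n hn ↦ iSup_le fun f ↦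
    (h n hn f (hΘ f f.2)).trans ?_⟩
  have hsum : ∑ i : Fin n, (n * (∫ u in ((i : ℝ) / n)..(((i : ℝ) + 1) / n), f.1 u) -
      f.1 (((i : ℝ) + 1) / n)) ^ 2 = ∑ i ∈ Finset.Icc 1 n,
        ((n : ℝ) * (∫ u in (((i : ℝ) - 1) / n)..((i : ℝ) / n), f.1 u) -
          f.1 ((i : ℝ) / n)) ^ 2 := by
    -- Indices `0, …, n - 1` with cells `[i / n, (i + 1) / n]` become `1, …, n` with cells `[(i - 1)
    -- / n, i / n]`.
    rw [← Finset.Ico_add_one_right_eq_Icc, Finset.sum_Ico_eq_sum_range, Nat.add_sub_cancel,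
      Finset.sum_range]
    refine Finset.sum_congr rfl fun i _ ↦ ?_
    push_cast
    rw [add_comm (1 : ℝ), add_sub_cancel_right]
  have hM : 0 ≤ max ((n : ℝ) ^ (1 - 2 * H)) 1 := le_max_of_le_right zero_le_one
  rw [hsum, ENNReal.ofReal_mul zero_le_two, ENNReal.ofReal_ofNat, Real.sqrt_eq_rpow,
    ← ENNReal.ofReal_rpow_of_nonneg (by positivity) (by norm_num), ENNReal.ofReal_mul hC.le,
    ENNReal.ofReal_mul hM]
  gcongr
  exact le_iSup₂ (f := fun (f : ℝ → ℝ) (_ : f ∈ Θ) ↦ ENNReal.ofReal (∑ i ∈ Finset.Icc 1 n,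
    ((n : ℝ) * (∫ u in (((i : ℝ) - 1) / n)..((i : ℝ) / n), f u) - f ((i : ℝ) / n)) ^ 2)) f.1 f.2

end AsymptoticEquivalence

theorem theorem1 {Ω Ω' : Type*} [MeasurableSpace Ω] [MeasurableSpace Ω']
    {P : Measure Ω} {P' : Measure Ω'} {H : ℝ} (hH : H ∈ Set.Ioo (0 : ℝ) 1)
    {N : ℕ → Ω → ℝ} (hN : IsFractionalGaussianNoise H N P)
    {B : ℝ≥0 → Ω' → ℝ} (hB : IsFractionalBrownianMotion H B P')
    (Θ : Set (ℝ → ℝ)) (hΘ : ∀ f ∈ Θ, IntervalIntegrable f volume 0 1)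
    (hi : Tendsto (fun n : ℕ ↦ ENNReal.ofReal (max ((n : ℝ) ^ (1 - 2 * H)) 1) *
      ⨆ f ∈ Θ, ENNReal.ofReal (∑ i ∈ Finset.Icc 1 n,
        ((n : ℝ) * (∫ u in (((i : ℝ) - 1) / n)..((i : ℝ) / n), f u) - f ((i : ℝ) / n)) ^ 2))
      atTop (𝓝 0))
    (hii : Tendsto (fun n : ℕ ↦ ENNReal.ofReal ((n : ℝ) ^ (1 - H)) *
      ⨆ f ∈ Θ, ⨅ α : Fin n → ℝ, fbmRKHSENorm hH (fun t : unitInterval ↦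
        (∫ u in (0 : ℝ)..t, f u) - ∑ j : Fin n, α j * fbmCov H t (((j : ℝ) + 1) / n)))
      atTop (𝓝 0)) :
    AsymptoticallyEquivalent
      (fun n (f : Θ) ↦ regressionLaw N P n f)
      (fun n (f : Θ) ↦ continuousLaw hB n f (hΘ f f.2)) := by
  obtain ⟨C, hC, h⟩ := exists_iSup_tvDist_le hH hN hB Θ hΘ
  refine tendsto_of_tendsto_of_tendsto_of_le_of_le' tendsto_const_nhds
    (h := fun n : ℕ ↦ 2 * (C * (ENNReal.ofReal (max ((n : ℝ) ^ (1 - 2 * H)) 1) *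
        ⨆ f ∈ Θ, ENNReal.ofReal (∑ i ∈ Finset.Icc 1 n,
          ((n : ℝ) * (∫ u in (((i : ℝ) - 1) / n)..((i : ℝ) / n), f u) - f ((i : ℝ) / n)) ^ 2)))
        ^ (1 / 2 : ℝ) +
      2 * (ENNReal.ofReal ((n : ℝ) ^ (1 - H)) *
        ⨆ f ∈ Θ, ⨅ α : Fin n → ℝ, fbmRKHSENorm hH (fun t : unitInterval ↦
          (∫ u in (0 : ℝ)..t, f u) - ∑ j : Fin n, α j * fbmCov H t (((j : ℝ) + 1) / n))))
    ?_ (Eventually.of_forall fun _ ↦ zero_le) ?_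
  · have h1 := ENNReal.Tendsto.const_mul (a := 2) ((ENNReal.continuous_rpow_const
      (y := (1 / 2 : ℝ))).tendsto _ |>.comp (ENNReal.Tendsto.const_mul (a := C) hi (.inr hC)))
      (.inr (by simp))
    have h2 := ENNReal.Tendsto.const_mul (a := 2) hii (.inr (by simp))
    have := h1.add h2
    simpa using this
  · filter_upwards [eventually_gt_atTop 0] with n hn
    refine (leCamDist_le hH hN hB hn Θ hΘ).trans ?_
    rw [mul_assoc 2]
    exact add_le_add_left (h n hn) _
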